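/- **Setting.** Let $\lambda>0$ (friction), $m_p>0$ (mass of the particle), $\mu>0$, $h^0,v^0\in\mathbb R$, and let $u^0\in BV(\mathbb R)\cap L^1(\mathbb R)$. Let $g,\ g^-_\lambda,\ g^+_\lambda:\mathbb R^3\to\mathbb R$ be locally Lipschitz, nondecreasing in their first and nonincreasing in their second argument, such that for all $a,b,v\in\mathbb R$ $$g(a,a,v)=\tfrac{a^2}{2}-va,\qquad g^-_\lambda(v,v,v)=g^+_\lambda(v,v,v),$$ $$a=b+\lambda\ \Longrightarrow\ g^-_\lambda(a,b,v)=\tfrac{a^2}{2}-va\ \text{ and }\ g^+_\lambda(a,b,v)=\tfrac{b^2}{2}-vb,$$ and such that $g^-_\lambda-g^+_\lambda$ is nondecreasing in each of its first two arguments. Put $$m=\min\{\operatorname*{ess\,inf}_{(-\infty,h^0)}u^0-\lambda,\ \operatorname*{ess\,inf}_{(h^0,\infty)}u^0\},\qquad M=\max\{\operatorname*{ess\,sup}_{(-\infty,h^0)}u^0,\ \operatorname*{ess\,sup}_{(h^0,\infty)}u^0+\lambda\},$$ $\underline v=\min(m,v^0)$, $\bar v=\max(M,v^0)$, and let $L$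 be the largest of the best Lipschitz constants of $g,g^-_\lambda,g^+_\lambda$ on $[m,M]^2\times[\underline v,\bar v]$ (with respect to the norm $|a|+|b|+|v|$). Assume the CFL condition $L\mu\le\frac12$. **Scheme.** For a time step $\Delta t>0$ let $\Delta x=\Delta t/\mu$, $x^0_{j-1/2}=h^0+(j-1)\Delta x$ and $u^0_j=\frac1{\Delta x}\int_{x^0_{j-1/2}}^{x^0_{j+1/2}}u^0\,dx$ for $j\in\mathbb Z$. The velocity recursion starts from the given $v^0$, and for $n\ge 0$ $$\begin{cases} u_j^{n+1}=u_j^n-\mu\big(g(u_j^n,u_{j+1}^n,v^n)-g(u_{j-1}^n,u_j^n,v^n)\big),& j\notin\{0,1\},\\ u_0^{n+1}=u_0^n-\mu\big(g^-_\lambda(u_0^n,u_1^n,v^n)-g(u_{-1}^n,u_0^n,v^n)\big),\\ u_1^{n+1}=u_1^n-\mu\big(g(u_1^n,u_2^n,v^n)-g^+_\lambda(u_0^n,u_1^n,v^n)\big),\\ v^{n+1}=v^n+\frac{\Delta t}{m_p}\big(g^-_\lambda(u_0^n,u_1^n,v^n)-g^+_\lambda(u_0^n,u_1^n,v^n)\big),\\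 x^{n+1}_{j-1/2}=x^n_{j-1/2}+v^n\Delta t. \end{cases}$$ Let $u_{\Delta t}(t,x)=u_j^n$ if $(t,x)=(n\Delta t+s,\ x^n_{j-1/2}+y+sv^n)$ with $0\le s<\Delta t$, $0\le y<\Delta x$, and let $h_{\Delta t}(t)=h^0+\Delta t\sum_{k=0}^{n-1}v^k+v^n(t-n\Delta t)$ if $n\Delta t\le t<(n+1)\Delta t$. **Proposition.** For every sequence of positive time steps tending to $0$ (with $\mu$ fixed) there exist a subsequence $(\Delta t_k)_k$, a function $u\in BV_{loc}(\mathbb R_+\times\mathbb R)$ and a function $h\in W^{2,\infty}_{loc}(\mathbb R_+)$ such that $u_{\Delta t_k}\to u$ in $L^1_{loc}(\mathbb R_+\times\mathbb R)$ and $h_{\Delta t_k}\to h$ in $W^{1,\infty}_{loc}(\mathbb R_+)$. Here $\mathbb R_+=[0,\infty)$, and "loc" means on all $(0,T)\times(-A,A)$, respectively on all $(0,T)$, with $T,A>0$. -/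

import Mathlib

open MeasureTheory Set Filter Topology
open scoped ENNReal ContDiff

noncomputable section

namespace FluidParticle

/-! ### Function spaces -/

/-- `f` is in `BV(Ω)`, `Ω` an open set: `f` is integrable on `Ω` and each of its distributional
directional derivatives is a finite measure on `Ω`, i.e. `φ ↦ ∫_Ω f ∂_e φ` is bounded on the
functions `φ ∈ C¹_c(Ω)` with `|φ| ≤ 1`. -/
def MemBV {E : Type*} [NormedAddCommGroup E] [NormedSpace ℝ E] [MeasureSpace E]
    (Ω : Set E) (f : E → ℝ) : Prop :=
  IntegrableOn f Ω volume ∧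
    ∀ e : E, ∃ C : ℝ, ∀ φ : E → ℝ, ContDiff ℝ 1 φ → HasCompactSupport φ → tsupport φ ⊆ Ω →
      (∀ x, |φ x| ≤ 1) → ∫ x in Ω, f x * fderiv ℝ φ x e ≤ C

/-- `u ∈ BV_loc(ℝ₊ × ℝ)`, where `ℝ₊ = [0, ∞)`: the function `u` of `(t, x)` is of bounded
variation on every rectangle `(0, T) × (-A, A)` (so up to the boundary `t = 0`). -/
def MemBVLoc (u : ℝ × ℝ → ℝ) : Prop :=
  ∀ T > 0, ∀ A > 0, MemBV (Ioo (0 : ℝ) T ×ˢ Ioo (-A) A) u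

/-- Convergence in `L¹_loc(ℝ₊ × ℝ)`, where `ℝ₊ = [0, ∞)`. -/
def TendstoL1Loc (U : ℕ → ℝ × ℝ → ℝ) (u : ℝ × ℝ → ℝ) : Prop :=
  ∀ K : Set (ℝ × ℝ), IsCompact K → K ⊆ Ici 0 ×ˢ univ →
    Tendsto (fun k => eLpNorm (U k - u) 1 (volume.restrict K)) atTop (𝓝 0)

/-- `f'` is a weak derivative of `f` on the open set `Ω ⊆ ℝ`. -/
def HasWeakDeriv (Ω : Set ℝ) (f f' : ℝ → ℝ) : Prop :=
  LocallyIntegrableOn f Ω volume ∧ LocallyIntegrableOn f' Ω volume ∧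
    ∀ φ : ℝ → ℝ, ContDiff ℝ ∞ φ → HasCompactSupport φ → tsupport φ ⊆ Ω →
      ∫ x in Ω, f x * deriv φ x = -∫ x in Ω, f' x * φ x

/-- `f ∈ W^{k,∞}(Ω)`. -/
def MemWInf (Ω : Set ℝ) : ℕ → (ℝ → ℝ) → Prop
  | 0, f => MemLp f ∞ (volume.restrict Ω)
  | k + 1, f => MemLp f ∞ (volume.restrict Ω) ∧ ∃ f', HasWeakDeriv Ω f f' ∧ MemWInf Ω k f'

/-- `f ∈ W^{k,∞}_loc(ℝ₊)`, where `ℝ₊ = [0, ∞)`. -/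
def MemWInfLoc (k : ℕ) (f : ℝ → ℝ) : Prop :=
  ∀ T > 0, MemWInf (Ioo 0 T) k f

/-- The norm `‖f‖_{L^∞(Ω)} + ‖f'‖_{L^∞(Ω)}` of `W^{1,∞}(Ω)`, equal to `∞` if `f` has no weak
derivative. The weak derivative is unique almost everywhere, so that all terms of the infimum
agree. -/
def normW1Inf (Ω : Set ℝ) (f : ℝ → ℝ) : ℝ≥0∞ :=
  ⨅ (f' : ℝ → ℝ) (_ : HasWeakDeriv Ω f f'),
    eLpNorm f ∞ (volume.restrict Ω) + eLpNorm f' ∞ (volume.restrict Ω)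

/-- Convergence in `W^{1,∞}_loc(ℝ₊)`, where `ℝ₊ = [0, ∞)`. -/
def TendstoW1InfLoc (H : ℕ → ℝ → ℝ) (h : ℝ → ℝ) : Prop :=
  ∀ T > 0, Tendsto (fun k => normW1Inf (Ioo 0 T) (H k - h)) atTop (𝓝 0)

/-! ### The finite volume scheme -/

/-- The data of the scheme: the friction `lam`, the mass of the particle, the ratio
`mu = Δt / Δx`, the flux `g (a, b, v)` away from the particle, the fluxes `gMinus` and `gPlus` on
the left and on the right of the particle, the initial velocity `u0` of the fluid, and the initial
position `h0` and velocity `v0` of the particle. -/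
structure SchemeData where
  lam : ℝ
  mass : ℝ
  mu : ℝ
  g : ℝ → ℝ → ℝ → ℝ
  gMinus : ℝ → ℝ → ℝ → ℝ
  gPlus : ℝ → ℝ → ℝ → ℝ
  u0 : ℝ → ℝ
  h0 : ℝ
  v0 : ℝ

/-- The part `𝒢¹_λ` of the germ. -/
def germ1 (lam : ℝ) : Set (ℝ × ℝ) := {p | p.1 = p.2 + lam}

namespace SchemeData

variable (D : SchemeData)

/-- The hypotheses on the fluxes. -/
structure FluxHypotheses : Prop where
  g_consistent : ∀ a v, D.g a a v = a ^ 2 / 2 - v * a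
  g_mono_fst : ∀ b v, Monotone fun a => D.g a b v
  g_anti_snd : ∀ a v, Antitone fun b => D.g a b v
  g_lipschitz : LocallyLipschitz fun p : ℝ × ℝ × ℝ => D.g p.1 p.2.1 p.2.2
  germ_consistent : ∀ v, ∀ p ∈ germ1 D.lam,
    D.gMinus p.1 p.2 v = p.1 ^ 2 / 2 - v * p.1 ∧ D.gPlus p.1 p.2 v = p.2 ^ 2 / 2 - v * p.2
  equal_velocity : ∀ v, D.gMinus v v v = D.gPlus v v v
  gMinus_lipschitz : LocallyLipschitz fun p : ℝ × ℝ × ℝ => D.gMinus p.1 p.2.1 p.2.2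
  gPlus_lipschitz : LocallyLipschitz fun p : ℝ × ℝ × ℝ => D.gPlus p.1 p.2.1 p.2.2
  gMinus_mono_fst : ∀ b v, Monotone fun a => D.gMinus a b v
  gMinus_anti_snd : ∀ a v, Antitone fun b => D.gMinus a b v
  gPlus_mono_fst : ∀ b v, Monotone fun a => D.gPlus a b v
  gPlus_anti_snd : ∀ a v, Antitone fun b => D.gPlus a b v
  dissipative_fst : ∀ b v, Monotone fun a => D.gMinus a b v - D.gPlus a b v
  dissipative_snd : ∀ a v, Monotone fun b => D.gMinus a b v - D.gPlus a b v

/-- The lower bound `m`; the particle starts at `h0`. -/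
def lowerBound : ℝ :=
  min (essInf D.u0 (volume.restrict (Iio D.h0)) - D.lam)
    (essInf D.u0 (volume.restrict (Ioi D.h0)))

/-- The upper bound `M`. -/
def upperBound : ℝ :=
  max (essSup D.u0 (volume.restrict (Iio D.h0)))
    (essSup D.u0 (volume.restrict (Ioi D.h0)) + D.lam)

/-- The box `[m, M]² × [min (m, v⁰), max (M, v⁰)]`. -/
def box : Set (ℝ × ℝ × ℝ) :=
  Icc D.lowerBound D.upperBound ×ˢ Icc D.lowerBound D.upperBound ×ˢ
    Icc (min D.lowerBound D.v0) (max D.upperBound D.v0)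

/-- `L` is a Lipschitz constant of `f` on `S`, with respect to the norm `|a| + |b| + |v|`
(for a Lipschitz function on a box, a common bound of the partial derivatives). -/
def IsLipschitzConst (L : ℝ) (f : ℝ → ℝ → ℝ → ℝ) (S : Set (ℝ × ℝ × ℝ)) : Prop :=
  ∀ p ∈ S, ∀ q ∈ S, |f p.1 p.2.1 p.2.2 - f q.1 q.2.1 q.2.2| ≤
    L * (|p.1 - q.1| + |p.2.1 - q.2.1| + |p.2.2 - q.2.2|)

/-- The condition `L μ ≤ 1/2`, where `L` is the largest of the (best) Lipschitz constants of
`g`, `gMinus`, `gPlus` on the box. -/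
def CFL : Prop :=
  ∃ L : ℝ, IsLipschitzConst L D.g D.box ∧ IsLipschitzConst L D.gMinus D.box ∧
    IsLipschitzConst L D.gPlus D.box ∧ L * D.mu ≤ 1 / 2

/-- The space step `Δx`, given the time step `Δt`. -/
def dx (dt : ℝ) : ℝ := dt / D.mu

/-- The initial interface `x_{j-1/2}⁰` between the cells `j - 1` and `j`: the particle, at `h0`,
is between the cells `0` and `1`. -/
def interface (dt : ℝ) (j : ℤ) : ℝ := D.h0 + (j - 1) * D.dx dt

/-- The initial cell averages. -/
def initial (dt : ℝ) (j : ℤ) : ℝ :=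
  (1 / D.dx dt) * ∫ x in D.interface dt j..D.interface dt (j + 1), D.u0 x

/-- The flux at the right end of the cell `j`. -/
def rightFlux (u : ℤ → ℝ) (v : ℝ) (j : ℤ) : ℝ :=
  if j = 0 then D.gMinus (u 0) (u 1) v else D.g (u j) (u (j + 1)) v

/-- The flux at the left end of the cell `j`. -/
def leftFlux (u : ℤ → ℝ) (v : ℝ) (j : ℤ) : ℝ :=
  if j = 1 then D.gPlus (u 0) (u 1) v else D.g (u (j - 1)) (u j) v

/-- The scheme: `(state dt n).1 j` is `u_j^n` and `(state dt n).2` is `v^n`. -/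
def state (dt : ℝ) : ℕ → (ℤ → ℝ) × ℝ
  | 0 => (D.initial dt, D.v0)
  | n + 1 =>
    let u := (state dt n).1
    let v := (state dt n).2
    (fun j => u j - D.mu * (D.rightFlux u v j - D.leftFlux u v j),
      v + dt / D.mass * (D.gMinus (u 0) (u 1) v - D.gPlus (u 0) (u 1) v))

/-- The approximate trajectory `h_Δt` (for `t ≥ 0`). -/
def hApprox (dt t : ℝ) : ℝ :=
  let n := ⌊t / dt⌋₊
  D.h0 + dt * ∑ m ∈ Finset.range n, (D.state dt m).2 + (D.state dt n).2 * (t - n * dt)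

/-- The approximate fluid velocity `u_Δt` (for `t ≥ 0`): the value `u_j^n` on the cell `C_j^n`.
See `uApprox_eq_of_mem_cell`. -/
def uApprox (dt : ℝ) (p : ℝ × ℝ) : ℝ :=
  (D.state dt ⌊p.1 / dt⌋₊).1 (⌊(p.2 - D.hApprox dt p.1) / D.dx dt⌋ + 1)

/-- The interface `x_{j-1/2}^n` of the mesh that follows the particle. -/
def meshPoint (dt : ℝ) (j : ℤ) : ℕ → ℝ
  | 0 => D.interface dt j
  | n + 1 => meshPoint dt j n + (D.state dt n).2 * dt

/-- The space-time cell `C_j^n`. -/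
def cell (dt : ℝ) (n : ℕ) (j : ℤ) : Set (ℝ × ℝ) :=
  {p | ∃ s y : ℝ, 0 ≤ s ∧ s < dt ∧ 0 ≤ y ∧ y < D.dx dt ∧
    p = (n * dt + s, D.meshPoint dt j n + y + s * (D.state dt n).2)}

theorem meshPoint_eq (dt : ℝ) (j : ℤ) (n : ℕ) :
    D.meshPoint dt j n =
      D.interface dt j + dt * ∑ m ∈ Finset.range n, (D.state dt m).2 := by
  induction n with
  | zero => simp [meshPoint]
  | succ n ih => rw [meshPoint, ih, Finset.sum_range_succ]; ring

theorem uApprox_eq_of_mem_cell {dt : ℝ} (hdt : 0 < dt) (hmu : 0 < D.mu) {n : ℕ} {j : ℤ}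
    {p : ℝ × ℝ} (hp : p ∈ D.cell dt n j) : D.uApprox dt p = (D.state dt n).1 j := by
  obtain ⟨s, y, hs0, hs, hy0, hy, rfl⟩ := hp
  have hdx : 0 < D.dx dt := div_pos hdt hmu
  have hn : ⌊(n * dt + s) / dt⌋₊ = n := by
    rw [Nat.floor_eq_iff (by positivity)]
    constructor
    · rw [le_div_iff₀ hdt]; linarith
    · rw [div_lt_iff₀ hdt]; linarith
  have hj : ⌊(D.meshPoint dt j n + y + s * (D.state dt n).2 - D.hApprox dt (n * dt + s))
      / D.dx dt⌋ = j - 1 := by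
    have : D.meshPoint dt j n + y + s * (D.state dt n).2 - D.hApprox dt (n * dt + s)
        = (j - 1) * D.dx dt + y := by
      rw [meshPoint_eq, hApprox, hn, interface]; ring
    rw [this, Int.floor_eq_iff]
    push_cast
    constructor
    · rw [le_div_iff₀ hdx]; linarith
    · rw [div_lt_iff₀ hdx]; linarith
  simp only [uApprox, hn, hj, sub_add_cancel]

end SchemeData

end FluidParticle

end

open FluidParticle

/-! The proof is a Helly-type compactness argument resting on bounds that are uniform in the time
step.

Adding `lam` to the fluid velocities on the right of the particle turns each germ pair `a = b + lam`
into a pair of equal states. For the shifted sequence `w` the whole scheme, including the two cells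
next to the particle, has the incremental form `w' j = w j + P j - Q (j - 1)`. Monotonicity of the
fluxes gives `P j` and `Q j` the sign of the jump `w (j + 1) - w j`, and the CFL condition bounds
each by half of that jump. Harten's argument then shows that bounds are preserved, that the total
variation does not increase, and that one step changes the sequence in `ℓ¹` by at most its variation
(`seqVariation_update_le`, `tsum_update_sub_le`, `update_mem_Icc`). The force `gMinus - gPlus` is
nondecreasing in the fluid states and vanishes when both equal the particle velocity. Towards an
endpoint of the velocity interval it is therefore at most a constant times the distance to that
endpoint, so small time steps keep the velocity inside (`exists_stepBounds`). At time `0`, the weak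
definition of `BV` gives an `L¹` Lipschitz estimate for translates, which bounds `u0` and the
variation of its cell averages.

Hence the functions `uApprox` are uniformly bounded, of uniformly bounded variation in `x`, and
Lipschitz in time with values in `L¹` up to an error of order `dt` (`UniformBV`). A diagonal
subsequence makes their primitives in `x` converge at rational points and times; averaging in `x`
turns this into `L¹` convergence of time slices, and the time estimate reaches all times. The limit
is `BV` by duality, moving difference quotients to the test function. The particle velocities
converge locally uniformly by an Arzelà–Ascoli argument to a Lipschitz limit, whose primitive is
`h`. -/

namespace FluidParticle

/-! ### Incremental updates of sequences (Harten's lemma) -/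

/-- The total variation of a sequence on `ℤ`. -/
noncomputable def seqVariation (w : ℤ → ℝ) : ℝ≥0∞ := ∑' j, ‖w (j + 1) - w j‖ₑ

/-- `p` lies between `0` and half of `d`. -/
def IsHalfPart (p d : ℝ) : Prop := (0 ≤ d → 0 ≤ p ∧ p ≤ d / 2) ∧ (d ≤ 0 → d / 2 ≤ p ∧ p ≤ 0)

/-- Two half parts never overshoot: `d - p - q`, `p` and `q` all have the sign of `d`, so there is
no cancellation. -/
theorem IsHalfPart.abs_sub_sub {p q d : ℝ} (hp : IsHalfPart p d) (hq : IsHalfPart q d) :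
    |d| = |d - p - q| + |p| + |q| := by
  rcases le_total 0 d with h | h
  · obtain ⟨h1, h2⟩ := hp.1 h
    obtain ⟨h3, h4⟩ := hq.1 h
    rw [abs_of_nonneg h, abs_of_nonneg h1, abs_of_nonneg h3, abs_of_nonneg (by linarith)]
    ring
  · obtain ⟨h1, h2⟩ := hp.2 h
    obtain ⟨h3, h4⟩ := hq.2 h
    rw [abs_of_nonpos h, abs_of_nonpos h2, abs_of_nonpos h4, abs_of_nonpos (by linarith)]
    ring

theorem IsHalfPart.abs_le {p d : ℝ} (hp : IsHalfPart p d) : |p| ≤ |d| / 2 := by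
  rcases le_total 0 d with h | h
  · obtain ⟨h1, h2⟩ := hp.1 h
    rw [abs_of_nonneg h, abs_of_nonneg h1]
    linarith
  · obtain ⟨h1, h2⟩ := hp.2 h
    rw [abs_of_nonpos h, abs_of_nonpos h2]
    linarith

theorem isHalfPart_of_abs_le {p d : ℝ} (h1 : 0 ≤ d → 0 ≤ p) (h2 : d ≤ 0 → p ≤ 0)
    (h3 : |p| ≤ 1 / 2 * |d|) : IsHalfPart p d := by
  constructor
  · intro h
    have := h1 h
    rw [abs_of_nonneg h, abs_of_nonneg this] at h3
    exact ⟨this, by linarith⟩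
  · intro h
    have := h2 h
    rw [abs_of_nonpos h, abs_of_nonpos this] at h3
    exact ⟨by linarith, this⟩

/-- A three-point update with incremental coefficients in `[0, 1/2]` does not increase the total
variation. -/
theorem seqVariation_update_le {w w' P Q : ℤ → ℝ}
    (hw : ∀ j, w' j = w j + P j - Q (j - 1))
    (hP : ∀ j, IsHalfPart (P j) (w (j + 1) - w j))
    (hQ : ∀ j, IsHalfPart (Q j) (w (j + 1) - w j)) :
    seqVariation w' ≤ seqVariation w := by
  have h1 : ∀ j, ‖w (j + 1) - w j‖ₑ = ‖w (j + 1) - w j - P j - Q j‖ₑ + ‖P j‖ₑ + ‖Q j‖ₑ := by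
    intro j
    simp only [Real.enorm_eq_ofReal_abs]
    rw [(hP j).abs_sub_sub (hQ j), ENNReal.ofReal_add (by positivity) (by positivity),
      ENNReal.ofReal_add (by positivity) (by positivity)]
  have h2 : ∀ j, ‖w' (j + 1) - w' j‖ₑ ≤
      ‖w (j + 1) - w j - P j - Q j‖ₑ + ‖P (j + 1)‖ₑ + ‖Q (j - 1)‖ₑ := by
    intro j
    -- The new jump keeps `d - P j - Q j` of the old one and receives `P (j + 1)` and `Q (j - 1)`
    -- from its neighbours. After summation and reindexing, what each jump gives away equals what
    -- the others receive. The sums live in `ℝ≥0∞`, so no summability is needed.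
    have : w' (j + 1) - w' j = (w (j + 1) - w j - P j - Q j) + P (j + 1) + Q (j - 1) := by
      rw [hw, hw, add_sub_cancel_right]; ring
    rw [this]
    exact (enorm_add_le _ _).trans (by gcongr; exact enorm_add_le _ _)
  have h3 : ∑' j, ‖P (j + 1)‖ₑ = ∑' j, ‖P j‖ₑ :=
    (Equiv.addRight (1 : ℤ)).tsum_eq fun j => ‖P j‖ₑ
  have h4 : ∑' j, ‖Q (j - 1)‖ₑ = ∑' j, ‖Q j‖ₑ :=
    (Equiv.subRight (1 : ℤ)).tsum_eq fun j => ‖Q j‖ₑ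
  calc seqVariation w' ≤ _ := ENNReal.tsum_le_tsum h2
    _ = seqVariation w := by
      rw [seqVariation, tsum_congr h1]
      simp only [ENNReal.tsum_add, h3, h4]

theorem tsum_update_sub_le {w w' P Q : ℤ → ℝ}
    (hw : ∀ j, w' j = w j + P j - Q (j - 1))
    (hP : ∀ j, IsHalfPart (P j) (w (j + 1) - w j))
    (hQ : ∀ j, IsHalfPart (Q j) (w (j + 1) - w j)) :
    ∑' j, ‖w' j - w j‖ₑ ≤ seqVariation w := by
  have h2 : ∀ j, ‖w' j - w j‖ₑ ≤ ‖P j‖ₑ + ‖Q (j - 1)‖ₑ := by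
    intro j
    have : w' j - w j = P j - Q (j - 1) := by rw [hw]; ring
    rw [this]
    exact enorm_sub_le
  have h4 : ∑' j, ‖Q (j - 1)‖ₑ = ∑' j, ‖Q j‖ₑ :=
    (Equiv.subRight (1 : ℤ)).tsum_eq fun j => ‖Q j‖ₑ
  calc ∑' j, ‖w' j - w j‖ₑ ≤ _ := ENNReal.tsum_le_tsum h2
    _ = ∑' j, (‖P j‖ₑ + ‖Q j‖ₑ) := by rw [ENNReal.tsum_add, h4, ENNReal.tsum_add]
    _ ≤ seqVariation w := by
      refine ENNReal.tsum_le_tsum fun j => ?_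
      simp only [Real.enorm_eq_ofReal_abs]
      rw [← ENNReal.ofReal_add (by positivity) (by positivity)]
      apply ENNReal.ofReal_le_ofReal
      linarith [(hP j).abs_le, (hQ j).abs_le]

/-- The new value moves at most half way towards each neighbour, so it is a convex combination of
three old values. -/
theorem update_mem_Icc {w w' P Q : ℤ → ℝ} {a b : ℝ}
    (hw : ∀ j, w' j = w j + P j - Q (j - 1))
    (hP : ∀ j, IsHalfPart (P j) (w (j + 1) - w j))
    (hQ : ∀ j, IsHalfPart (Q j) (w (j + 1) - w j)) (hab : ∀ j, w j ∈ Icc a b) (j : ℤ) :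
    w' j ∈ Icc a b := by
  have hQ' := hQ (j - 1)
  rw [sub_add_cancel] at hQ'
  have hP' := hP j
  have h0 := hab j
  have h1 := hab (j + 1)
  have h2 := hab (j - 1)
  rw [hw j]
  simp only [mem_Icc] at *
  rcases le_total 0 (w (j + 1) - w j) with h | h <;>
  rcases le_total 0 (w j - w (j - 1)) with h' | h'
  · have := hP'.1 h; have := hQ'.1 h'; constructor <;> linarith
  · have := hP'.1 h; have := hQ'.2 h'; constructor <;> linarith
  · have := hP'.2 h; have := hQ'.1 h'; constructor <;> linarith
  · have := hP'.2 h; have := hQ'.2 h'; constructor <;> linarith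

/-! ### Stability of the scheme: invariant region, variation, particle velocity -/

namespace SchemeData

variable (D : SchemeData)

/-- The jump `lam` across the particle is added on the right of the particle. -/
noncomputable def shift (u : ℤ → ℝ) (j : ℤ) : ℝ := u j + if j ≤ 0 then 0 else D.lam

/-- The fluid velocities respect the invariant region. -/
def InRegion (u : ℤ → ℝ) : Prop :=
  ∀ j, D.shift u j ∈ Icc (D.lowerBound + D.lam) D.upperBound

/-- The interval of the particle velocities. -/
def velInterval : Set ℝ := Icc (min D.lowerBound D.v0) (max D.upperBound D.v0)

/-- The right increment of the scheme in cell `j`. -/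
noncomputable def rightInc (u : ℤ → ℝ) (v : ℝ) (j : ℤ) : ℝ :=
  D.mu * (u j ^ 2 / 2 - v * u j - D.rightFlux u v j)

/-- The left increment of the scheme in cell `j + 1`. -/
noncomputable def leftInc (u : ℤ → ℝ) (v : ℝ) (j : ℤ) : ℝ :=
  D.mu * (u (j + 1) ^ 2 / 2 - v * u (j + 1) - D.leftFlux u v (j + 1))

/-- The physical flux `u j ^ 2 / 2 - v * u j` of the cell is added and subtracted, which splits the
update into two increments. The shift does not depend on time and passes through. -/
theorem shift_update (u : ℤ → ℝ) (v : ℝ) (j : ℤ) :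
    D.shift (fun j => u j - D.mu * (D.rightFlux u v j - D.leftFlux u v j)) j =
      D.shift u j + D.rightInc u v j - D.leftInc u v (j - 1) := by
  simp only [shift, rightInc, leftInc, sub_add_cancel]
  ring

variable {D}

theorem InRegion.mem_Icc (hlam : 0 < D.lam) {u : ℤ → ℝ} (hu : D.InRegion u) (j : ℤ) :
    u j ∈ Icc D.lowerBound D.upperBound := by
  have := hu j
  simp only [shift, Set.mem_Icc] at *
  split_ifs at this <;> constructor <;> linarith

theorem half_lipschitz_fst {f : ℝ → ℝ → ℝ → ℝ} {L : ℝ} (hmu : 0 < D.mu)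
    (hL : L * D.mu ≤ 1 / 2) (hf : IsLipschitzConst L f D.box) {a a' b v : ℝ}
    (ha : a ∈ Icc D.lowerBound D.upperBound) (ha' : a' ∈ Icc D.lowerBound D.upperBound)
    (hb : b ∈ Icc D.lowerBound D.upperBound) (hv : v ∈ D.velInterval) :
    |D.mu * (f a b v - f a' b v)| ≤ 1 / 2 * |a - a'| := by
  have := hf (a, b, v) ⟨ha, hb, hv⟩ (a', b, v) ⟨ha', hb, hv⟩
  simp only [sub_self, abs_zero, add_zero] at this
  rw [abs_mul, abs_of_pos hmu]
  calc D.mu * |f a b v - f a' b v| ≤ D.mu * (L * |a - a'|) := by gcongr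
    _ = (L * D.mu) * |a - a'| := by ring
    _ ≤ 1 / 2 * |a - a'| := by gcongr

theorem half_lipschitz_snd {f : ℝ → ℝ → ℝ → ℝ} {L : ℝ} (hmu : 0 < D.mu)
    (hL : L * D.mu ≤ 1 / 2) (hf : IsLipschitzConst L f D.box) {a b b' v : ℝ}
    (ha : a ∈ Icc D.lowerBound D.upperBound) (hb : b ∈ Icc D.lowerBound D.upperBound)
    (hb' : b' ∈ Icc D.lowerBound D.upperBound) (hv : v ∈ D.velInterval) :
    |D.mu * (f a b v - f a b' v)| ≤ 1 / 2 * |b - b'| := by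
  have := hf (a, b, v) ⟨ha, hb, hv⟩ (a, b', v) ⟨ha, hb', hv⟩
  simp only [sub_self, abs_zero, zero_add, add_zero] at this
  rw [abs_mul, abs_of_pos hmu]
  calc D.mu * |f a b v - f a b' v| ≤ D.mu * (L * |b - b'|) := by gcongr
    _ = (L * D.mu) * |b - b'| := by ring
    _ ≤ 1 / 2 * |b - b'| := by gcongr

theorem isHalfPart_of_antitone {f : ℝ → ℝ → ℝ → ℝ} {L : ℝ} (hmu : 0 < D.mu)
    (hL : L * D.mu ≤ 1 / 2) (hf : IsLipschitzConst L f D.box) {a b b' v : ℝ}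
    (hm : Antitone fun b => f a b v)
    (ha : a ∈ Icc D.lowerBound D.upperBound) (hb : b ∈ Icc D.lowerBound D.upperBound)
    (hb' : b' ∈ Icc D.lowerBound D.upperBound) (hv : v ∈ D.velInterval) :
    IsHalfPart (D.mu * (f a b v - f a b' v)) (b' - b) := by
  apply isHalfPart_of_abs_le
  · intro h
    exact mul_nonneg hmu.le (sub_nonneg.2 (hm (by linarith)))
  · intro h
    exact mul_nonpos_of_nonneg_of_nonpos hmu.le (sub_nonpos.2 (hm (by linarith)))
  · rw [abs_sub_comm b' b]
    exact half_lipschitz_snd hmu hL hf ha hb hb' hv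

theorem isHalfPart_of_monotone {f : ℝ → ℝ → ℝ → ℝ} {L : ℝ} (hmu : 0 < D.mu)
    (hL : L * D.mu ≤ 1 / 2) (hf : IsLipschitzConst L f D.box) {a a' b v : ℝ}
    (hm : Monotone fun a => f a b v)
    (ha : a ∈ Icc D.lowerBound D.upperBound) (ha' : a' ∈ Icc D.lowerBound D.upperBound)
    (hb : b ∈ Icc D.lowerBound D.upperBound) (hv : v ∈ D.velInterval) :
    IsHalfPart (D.mu * (f a b v - f a' b v)) (a - a') := by
  apply isHalfPart_of_abs_le
  · intro h
    exact mul_nonneg hmu.le (sub_nonneg.2 (hm (by linarith)))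
  · intro h
    exact mul_nonpos_of_nonneg_of_nonpos hmu.le (sub_nonpos.2 (hm (by linarith)))
  · exact half_lipschitz_fst hmu hL hf ha ha' hb hv

/-- By consistency the physical flux is a value of the numerical flux: on the diagonal for `g`, on
the germ for `gMinus`. The increment is thus a difference of two flux values in the second argument
alone, to which monotonicity and the CFL condition apply. -/
theorem isHalfPart_rightInc (hlam : 0 < D.lam) (hmu : 0 < D.mu) (hflux : D.FluxHypotheses)
    (hCFL : D.CFL) {u : ℤ → ℝ} {v : ℝ} (hu : D.InRegion u) (hv : v ∈ D.velInterval) (j : ℤ) :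
    IsHalfPart (D.rightInc u v j) (D.shift u (j + 1) - D.shift u j) := by
  obtain ⟨L, hg, hgm, -, hL⟩ := hCFL
  have hI := hu.mem_Icc hlam
  by_cases hj : j = 0
  · subst hj
    have h0 := hu 0
    simp only [shift, le_refl, if_true, add_zero, Set.mem_Icc] at h0
    -- The germ partner of `u 0` is `u 0 - lam`. It lies in the box because the region, stated for
    -- the shifted sequence, gives `u 0 ≥ m + lam` on the left of the particle.
    have := isHalfPart_of_antitone hmu hL hgm (hflux.gMinus_anti_snd (u 0) v) (hI 0)
      (b := u 0 - D.lam) ⟨by linarith, by linarith⟩ (hI 1) hv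
    rw [(hflux.germ_consistent v (u 0, u 0 - D.lam) (by simp [germ1])).1] at this
    convert this using 1
    · simp [rightInc, rightFlux]
    · simp [shift]; ring
  · have := isHalfPart_of_antitone hmu hL hg (hflux.g_anti_snd (u j) v) (hI j) (hI j)
      (hI (j + 1)) hv
    rw [hflux.g_consistent] at this
    convert this using 1
    · simp [rightInc, rightFlux, hj]
    · simp only [shift]
      split_ifs <;> first | omega | ring

theorem isHalfPart_leftInc (hlam : 0 < D.lam) (hmu : 0 < D.mu) (hflux : D.FluxHypotheses)
    (hCFL : D.CFL) {u : ℤ → ℝ} {v : ℝ} (hu : D.InRegion u) (hv : v ∈ D.velInterval) (j : ℤ) :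
    IsHalfPart (D.leftInc u v j) (D.shift u (j + 1) - D.shift u j) := by
  obtain ⟨L, hg, -, hgp, hL⟩ := hCFL
  have hI := hu.mem_Icc hlam
  by_cases hj : j = 0
  · subst hj
    have h0 := hu 1
    simp only [shift, Set.mem_Icc, if_neg (show ¬ (1 : ℤ) ≤ 0 by norm_num)] at h0
    -- Here the germ partner `u 1 + lam` is the shifted value itself, hence at most `M`.
    have := isHalfPart_of_monotone hmu hL hgp (hflux.gPlus_mono_fst (u 1) v)
      (a := u 1 + D.lam) ⟨by linarith, by linarith⟩ (hI 0) (hI 1) hv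
    rw [(hflux.germ_consistent v (u 1 + D.lam, u 1) (by simp [germ1])).2] at this
    convert this using 1
    · simp [leftInc, leftFlux]
    · simp [shift]
  · have := isHalfPart_of_monotone hmu hL hg (hflux.g_mono_fst (u (j + 1)) v) (hI (j + 1)) (hI j)
      (hI (j + 1)) hv
    rw [hflux.g_consistent] at this
    convert this using 1
    · simp [leftInc, leftFlux, hj]
    · simp only [shift]
      split_ifs <;> first | omega | ring

/-- A single `K` serves twice: as a bound of the force it controls the change of the velocity per
step, and as a Lipschitz constant in `v` on the diagonal it keeps the velocity in its interval. -/
theorem FluxHypotheses.exists_force_bound (hflux : D.FluxHypotheses) (a b : ℝ) :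
    ∃ K : ℝ, 0 < K ∧ (∀ x ∈ Icc a b, ∀ y ∈ Icc a b, ∀ v ∈ Icc a b,
        |D.gMinus x y v - D.gPlus x y v| ≤ K) ∧
      ∀ x ∈ Icc a b, ∀ v ∈ Icc a b, ∀ v' ∈ Icc a b,
        |(D.gMinus x x v - D.gPlus x x v) - (D.gMinus x x v' - D.gPlus x x v')| ≤
          K * |v - v'| := by
  have hc : IsCompact (Icc a b ×ˢ Icc a b ×ˢ Icc a b) :=
    isCompact_Icc.prod (isCompact_Icc.prod isCompact_Icc)
  obtain ⟨K₁, h₁⟩ := LocallyLipschitzOn.exists_lipschitzOnWith_of_compact hc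
    (hflux.gMinus_lipschitz.locallyLipschitzOn)
  obtain ⟨K₂, h₂⟩ := LocallyLipschitzOn.exists_lipschitzOnWith_of_compact hc
    (hflux.gPlus_lipschitz.locallyLipschitzOn)
  obtain ⟨K₃, h₃⟩ := hc.exists_bound_of_continuousOn
    (hflux.gMinus_lipschitz.continuous.sub hflux.gPlus_lipschitz.continuous).continuousOn
  refine ⟨K₁ + K₂ + |K₃| + 1, by positivity, ?_, ?_⟩
  · intro x hx y hy v hv
    have := h₃ (x, y, v) ⟨hx, hy, hv⟩
    rw [Real.norm_eq_abs] at this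
    exact this.trans (by linarith [le_abs_self K₃, K₁.2, K₂.2])
  · intro x hx v hv v' hv'
    have e₁ := h₁.dist_le_mul (x, x, v) ⟨hx, hx, hv⟩ (x, x, v') ⟨hx, hx, hv'⟩
    have e₂ := h₂.dist_le_mul (x, x, v) ⟨hx, hx, hv⟩ (x, x, v') ⟨hx, hx, hv'⟩
    simp only [Prod.dist_eq, dist_self, Real.dist_eq] at e₁ e₂
    rw [max_eq_right (by positivity), max_eq_right (by positivity)] at e₁ e₂
    calc _ = |(D.gMinus x x v - D.gMinus x x v') - (D.gPlus x x v - D.gPlus x x v')| := by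
          congr 1; ring
      _ ≤ |D.gMinus x x v - D.gMinus x x v'| + |D.gPlus x x v - D.gPlus x x v'| := abs_sub _ _
      _ ≤ K₁ * |v - v'| + K₂ * |v - v'| := add_le_add e₁ e₂
      _ ≤ _ := by nlinarith [abs_nonneg K₃, abs_nonneg (v - v')]

/-- The particle velocity stays in its interval under the scheme. -/
theorem velocity_update_mem (hflux : D.FluxHypotheses) {K s x y v : ℝ}
    (hK : ∀ x ∈ D.velInterval, ∀ v ∈ D.velInterval, ∀ v' ∈ D.velInterval,
        |(D.gMinus x x v - D.gPlus x x v) - (D.gMinus x x v' - D.gPlus x x v')| ≤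
          K * |v - v'|) (hs : 0 ≤ s) (hsK : s * K ≤ 1)
    (hx : x ∈ D.velInterval) (hy : y ∈ D.velInterval) (hv : v ∈ D.velInterval) :
    v + s * (D.gMinus x y v - D.gPlus x y v) ∈ D.velInterval := by
  set a := min D.lowerBound D.v0
  set b := max D.upperBound D.v0
  have hab : a ≤ b := hx.1.trans hx.2
  have hb : b ∈ D.velInterval := ⟨hab, le_rfl⟩
  have ha : a ∈ D.velInterval := ⟨le_rfl, hab⟩
  have hz : ∀ v, D.gMinus v v v - D.gPlus v v v = 0 := fun v => by
    rw [hflux.equal_velocity, sub_self]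
  constructor
  · have h1 : D.gMinus a a v - D.gPlus a a v ≤ D.gMinus x y v - D.gPlus x y v :=
      (hflux.dissipative_fst a v hx.1).trans (hflux.dissipative_snd x v hy.1)
    have h2 := hK a ha v hv a ha
    rw [hz, sub_zero, abs_of_nonneg (sub_nonneg.2 hv.1)] at h2
    have h3 : -(K * (v - a)) ≤ D.gMinus x y v - D.gPlus x y v := by
      linarith [neg_abs_le (D.gMinus a a v - D.gPlus a a v)]
    have h4 := mul_le_mul_of_nonneg_left h3 hs
    have h5 := mul_le_mul_of_nonneg_right hsK (sub_nonneg.2 hv.1)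
    change a ≤ _
    linarith
  · have h1 : D.gMinus x y v - D.gPlus x y v ≤ D.gMinus b b v - D.gPlus b b v :=
      (hflux.dissipative_fst y v hx.2).trans (hflux.dissipative_snd b v hy.2)
    have h2 := hK b hb v hv b hb
    rw [hz, sub_zero, abs_sub_comm v b, abs_of_nonneg (sub_nonneg.2 hv.2)] at h2
    have h3 : D.gMinus x y v - D.gPlus x y v ≤ K * (b - v) := by
      linarith [le_abs_self (D.gMinus b b v - D.gPlus b b v)]
    have h4 := mul_le_mul_of_nonneg_left h3 hs
    have h5 := mul_le_mul_of_nonneg_right hsK (sub_nonneg.2 hv.2)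
    change _ ≤ b
    linarith

variable (D)

/-- The stability estimates for one step of the scheme. -/
structure StepBounds (K dt : ℝ) (n : ℕ) : Prop where
  inRegion : D.InRegion (D.state dt n).1
  vel_mem : (D.state dt n).2 ∈ D.velInterval
  variation_le : seqVariation (D.shift (D.state dt n).1) ≤ seqVariation (D.shift (D.initial dt))
  time_le : ∑' j, ‖(D.state dt (n + 1)).1 j - (D.state dt n).1 j‖ₑ ≤
    seqVariation (D.shift (D.initial dt))
  vel_le : |(D.state dt (n + 1)).2 - (D.state dt n).2| ≤ K * dt

variable {D}

theorem exists_stepBounds (hlam : 0 < D.lam) (hmass : 0 < D.mass) (hmu : 0 < D.mu)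
    (hflux : D.FluxHypotheses) (hCFL : D.CFL) :
    ∃ K : ℝ, 0 < K ∧ ∀ dt : ℝ, 0 < dt → dt * K ≤ 1 → D.InRegion (D.initial dt) →
      ∀ n, D.StepBounds K dt n := by
  obtain ⟨K, hK0, hK1, hK2⟩ := hflux.exists_force_bound (min D.lowerBound D.v0)
    (max D.upperBound D.v0)
  refine ⟨K / D.mass, by positivity, fun dt hdt hdtK hinit => ?_⟩
  have hsub : ∀ {x}, x ∈ Icc D.lowerBound D.upperBound → x ∈ D.velInterval := fun hx =>
    ⟨(min_le_left _ _).trans hx.1, hx.2.trans (le_max_left _ _)⟩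
  -- The estimates on the passage from `n` to `n + 1` follow from the three invariants at step `n`,
  -- so only the invariants need induction.
  have key : ∀ n, D.InRegion (D.state dt n).1 → (D.state dt n).2 ∈ D.velInterval →
      seqVariation (D.shift (D.state dt n).1) ≤ seqVariation (D.shift (D.initial dt)) →
      D.StepBounds (K / D.mass) dt n := by
    intro n h1 h2 h3
    refine ⟨h1, h2, h3, ?_, ?_⟩
    · refine le_trans (le_of_eq ?_) ((tsum_update_sub_le (D.shift_update _ _)
        (isHalfPart_rightInc hlam hmu hflux hCFL h1 h2)
        (isHalfPart_leftInc hlam hmu hflux hCFL h1 h2)).trans h3)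
      refine tsum_congr fun j => ?_
      simp [shift, state]
    · simp only [state, add_sub_cancel_left]
      rw [abs_mul, abs_of_pos (by positivity)]
      calc dt / D.mass * _ ≤ dt / D.mass * K := by
            gcongr
            exact hK1 _ (hsub (h1.mem_Icc hlam 0)) _ (hsub (h1.mem_Icc hlam 1)) _ h2
        _ = _ := by ring
  intro n
  induction n with
  | zero => exact key 0 hinit ⟨min_le_right _ _, le_max_right _ _⟩ le_rfl
  | succ n ih =>
    have hP := isHalfPart_rightInc hlam hmu hflux hCFL ih.inRegion ih.vel_mem
    have hQ := isHalfPart_leftInc hlam hmu hflux hCFL ih.inRegion ih.vel_mem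
    refine key (n + 1) ?_ ?_ ?_
    · exact update_mem_Icc (D.shift_update _ _) hP hQ ih.inRegion
    · refine velocity_update_mem hflux hK2 (by positivity) ?_
        (hsub (ih.inRegion.mem_Icc hlam 0)) (hsub (ih.inRegion.mem_Icc hlam 1)) ih.vel_mem
      calc dt / D.mass * K = dt * (K / D.mass) := by ring
        _ ≤ 1 := hdtK
    · exact (seqVariation_update_le (D.shift_update _ _) hP hQ).trans ih.variation_le

end SchemeData

/-! ### Translation estimate and boundedness for `BV` functions on the line -/

/-- The average of `χ` on `(x, x + δ)`. -/
noncomputable def fwdAverage (χ : ℝ → ℝ) (δ x : ℝ) : ℝ := δ⁻¹ * ∫ y in x..x + δ, χ y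

theorem abs_integral_le_of_abs_le {f : ℝ → ℝ} {B : ℝ} (hf : ∀ x, |f x| ≤ B) (a b : ℝ) :
    |∫ x in a..b, f x| ≤ B * |b - a| := by
  have := intervalIntegral.norm_integral_le_of_norm_le_const (a := a) (b := b) (f := f) (C := B)
    fun x _ => hf x
  simpa using this

theorem locallyIntegrable_of_abs_le {f : ℝ → ℝ} {B : ℝ} (hm : Measurable f)
    (hf : ∀ x, |f x| ≤ B) : LocallyIntegrable f volume := by
  have : MemLp f ∞ volume :=
    memLp_top_of_bound hm.aestronglyMeasurable B (Eventually.of_forall hf)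
  exact this.locallyIntegrable le_top

theorem intervalIntegrable_of_abs_le {f : ℝ → ℝ} {B : ℝ} (hm : Measurable f)
    (hf : ∀ x, |f x| ≤ B) (a b : ℝ) : IntervalIntegrable f volume a b :=
  ((locallyIntegrable_of_abs_le hm hf).integrableOn_isCompact isCompact_uIcc).intervalIntegrable

theorem abs_fwdAverage_le {χ : ℝ → ℝ} {B : ℝ} (hχ : ∀ x, |χ x| ≤ B) {δ : ℝ} (hδ : 0 < δ) (x : ℝ) :
    |fwdAverage χ δ x| ≤ B := by
  rw [fwdAverage, abs_mul, abs_of_pos (inv_pos.2 hδ)]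
  have := abs_integral_le_of_abs_le hχ x (x + δ)
  rw [add_sub_cancel_left, abs_of_pos hδ] at this
  calc δ⁻¹ * _ ≤ δ⁻¹ * (B * δ) := by gcongr
    _ = B := by field_simp

theorem continuous_fwdAverage {χ : ℝ → ℝ} {B : ℝ} (hm : Measurable χ) (hχ : ∀ x, |χ x| ≤ B)
    (δ : ℝ) : Continuous (fwdAverage χ δ) := by
  have hi := intervalIntegrable_of_abs_le hm hχ
  have hc : Continuous fun x => ∫ y in (0 : ℝ)..x, χ y := intervalIntegral.continuous_primitive hi 0
  have : fwdAverage χ δ = fun x => δ⁻¹ * ((∫ y in (0 : ℝ)..x + δ, χ y) - ∫ y in (0 : ℝ)..x, χ y) := by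
    funext x
    rw [fwdAverage, intervalIntegral.integral_interval_sub_left (hi _ _) (hi _ _)]
  rw [this]
  exact continuous_const.mul ((hc.comp (continuous_id.add continuous_const)).sub hc)

theorem tendsto_fwdAverage {χ : ℝ → ℝ} (hχ : LocallyIntegrable χ volume) {δ : ℕ → ℝ}
    (hδ : ∀ n, 0 < δ n) (hδ0 : Tendsto δ atTop (𝓝 0)) :
    ∀ᵐ x, Tendsto (fun n => fwdAverage χ (δ n) x) atTop (𝓝 (χ x)) := by
  filter_upwards [_root_.LocallyIntegrable.ae_hasDerivAt_integral hχ] with x hx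
  have h1 := (hx x).tendsto_slope_zero_right
  have h2 : Tendsto δ atTop (𝓝[>] 0) :=
    tendsto_nhdsWithin_iff.2 ⟨hδ0, Eventually.of_forall hδ⟩
  have := h1.comp h2
  simpa [Function.comp_def, fwdAverage] using this

theorem fwdAverage_eq_zero {χ : ℝ → ℝ} {R : ℝ} (hR : ∀ x, x ∉ Icc (-R) R → χ x = 0) {δ : ℝ}
    (hδ : 0 < δ) (x : ℝ) (hx : x ∉ Icc (-(R + δ)) R) : fwdAverage χ δ x = 0 := by
  rw [fwdAverage, intervalIntegral.integral_congr (g := fun _ => 0)]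
  · simp
  · intro y hy
    rw [uIcc_of_le (by linarith)] at hy
    apply hR
    rw [mem_Icc, not_and_or, not_le, not_le] at hx ⊢
    rcases hx with h | h
    · left; linarith [hy.2]
    · right; linarith [hy.1]

/-- A change of variables moves the translation to `χ`, and `χ (x - s) - χ x` is `s` times the
derivative of an average of `χ`, which is bounded by `1`. Since `χ` is only measurable, it is first
replaced by its averages `fwdAverage χ δ`, so that the test function is `C¹`; then `δ` tends to `0`.
-/
theorem MemBV.exists_forall_integral_translate_mul_le {u : ℝ → ℝ} (hu : MemBV univ u) :
    ∃ C : ℝ, 0 ≤ C ∧ ∀ s > 0, ∀ χ : ℝ → ℝ, Measurable χ → (∀ x, |χ x| ≤ 1) →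
      ∀ R : ℝ, (∀ x, x ∉ Icc (-R) R → χ x = 0) →
        ∫ x, (u (x + s) - u x) * χ x ≤ C * s := by
  obtain ⟨hint, hbv⟩ := hu
  rw [integrableOn_univ] at hint
  obtain ⟨C, hC⟩ := hbv 1
  simp only [Measure.restrict_univ, fderiv_apply_one_eq_deriv] at hC
  have hC0 : 0 ≤ C := by
    have := hC (fun _ => 0) contDiff_const HasCompactSupport.zero (by simp) (by simp)
    simpa using this
  refine ⟨C, hC0, fun s hs χ hm hχ R hR => ?_⟩
  have step : ∀ δ > 0, ∫ x, u x * (fwdAverage χ δ (x - s) - fwdAverage χ δ x) ≤ C * s := by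
    intro δ hδ
    set c := fwdAverage χ δ with hc
    have hcc : Continuous c := continuous_fwdAverage hm hχ δ
    have hcb : ∀ x, |c x| ≤ 1 := abs_fwdAverage_le hχ hδ
    have hci := fun a b => hcc.intervalIntegrable (μ := volume) a b
    set Z : ℝ → ℝ := fun x => ∫ y in (0 : ℝ)..x, c y with hZ
    have hZd : ∀ x, HasDerivAt Z (c x) x := fun x =>
      intervalIntegral.integral_hasDerivAt_right (hci _ _)
        hcc.aestronglyMeasurable.stronglyMeasurableAtFilter hcc.continuousAt
    set φ : ℝ → ℝ := fun x => s⁻¹ * (Z (x - s) - Z x) with hφ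
    have hφd : ∀ x, HasDerivAt φ (s⁻¹ * (c (x - s) - c x)) x := fun x =>
      (((hZd (x - s)).comp_sub_const x s).sub (hZd x)).const_mul _
    have hφ' : deriv φ = fun x => s⁻¹ * (c (x - s) - c x) := funext fun x => (hφd x).deriv
    have hφi : ∀ x, φ x = s⁻¹ * ∫ y in x..x - s, c y := fun x => by
      rw [hφ]
      simp only [hZ]
      rw [intervalIntegral.integral_interval_sub_left (hci _ _) (hci _ _)]
    have := hC φ ?_ ?_ (subset_univ _) ?_
    · rw [hφ'] at this
      have e : ∫ x, u x * (s⁻¹ * (c (x - s) - c x)) = s⁻¹ * ∫ x, u x * (c (x - s) - c x) := by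
        rw [← integral_const_mul]
        congr 1; funext x; ring
      rw [e, inv_mul_le_iff₀ hs] at this
      linarith
    · rw [contDiff_one_iff_deriv]
      refine ⟨fun x => (hφd x).differentiableAt, ?_⟩
      rw [hφ']
      fun_prop
    · refine HasCompactSupport.intro (K := Icc (-(R + δ)) (R + s)) isCompact_Icc fun x hx => ?_
      rw [hφi, intervalIntegral.integral_congr (g := fun _ => 0)]
      · simp
      · intro y hy
        rw [uIcc_of_ge (by linarith)] at hy
        apply fwdAverage_eq_zero hR hδ
        rw [mem_Icc, not_and_or, not_le, not_le] at hx ⊢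
        rcases hx with h | h
        · left; linarith [hy.2]
        · right; linarith [hy.1]
    · intro x
      rw [hφi, abs_mul, abs_of_pos (inv_pos.2 hs)]
      have := abs_integral_le_of_abs_le hcb x (x - s)
      rw [sub_sub_cancel_left, abs_neg, abs_of_pos hs, one_mul] at this
      calc s⁻¹ * _ ≤ s⁻¹ * s := by gcongr
        _ = 1 := inv_mul_cancel₀ hs.ne'
  set δ : ℕ → ℝ := fun n => 1 / ((n : ℝ) + 1) with hδ
  have hδp : ∀ n, 0 < δ n := fun n => by positivity
  have hlim := tendsto_fwdAverage (locallyIntegrable_of_abs_le hm hχ) hδp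
    tendsto_one_div_add_atTop_nhds_zero_nat
  have hlim' : ∀ᵐ x, Tendsto (fun n => fwdAverage χ (δ n) (x - s)) atTop (𝓝 (χ (x - s))) :=
    (measurePreserving_sub_right volume s).quasiMeasurePreserving.ae hlim
  have hT : Tendsto (fun n => ∫ x, u x * (fwdAverage χ (δ n) (x - s) - fwdAverage χ (δ n) x)) atTop
      (𝓝 (∫ x, u x * (χ (x - s) - χ x))) := by
    refine tendsto_integral_of_dominated_convergence (fun x => |u x| * 2) ?_ ?_ ?_ ?_
    · intro n
      have := continuous_fwdAverage hm hχ (δ n)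
      exact hint.aestronglyMeasurable.mul (by fun_prop : Continuous fun x =>
        fwdAverage χ (δ n) (x - s) - fwdAverage χ (δ n) x).aestronglyMeasurable
    · exact hint.abs.mul_const 2
    · intro n
      refine Eventually.of_forall fun x => ?_
      rw [norm_mul, Real.norm_eq_abs, Real.norm_eq_abs]
      gcongr
      refine (abs_sub _ _).trans ?_
      linarith [abs_fwdAverage_le hχ (hδp n) (x - s), abs_fwdAverage_le hχ (hδp n) x]
    · filter_upwards [hlim, hlim'] with x h1 h2
      exact tendsto_const_nhds.mul (h2.sub h1)
  have hle := le_of_tendsto' hT fun n => step _ (hδp n)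
  refine le_trans (le_of_eq ?_) hle
  have hχb : ∀ᵐ x, ‖χ x‖ ≤ 1 := Eventually.of_forall hχ
  have i1 : Integrable (fun x => u x * χ x) :=
    hint.mul_bdd hm.aestronglyMeasurable hχb
  have i2 : Integrable (fun x => u x * χ (x - s)) :=
    hint.mul_bdd (hm.comp (measurable_id.sub_const s)).aestronglyMeasurable
      (Eventually.of_forall fun x => hχ _)
  have i3 : Integrable (fun x => u (x + s) * χ x) := by
    have := i2.comp_add_right s
    simpa using this
  have e1 : ∫ x, u (x + s) * χ x = ∫ x, u x * χ (x - s) := by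
    rw [← integral_add_right_eq_self (fun x => u x * χ (x - s)) s]
    simp
  simp_rw [sub_mul, mul_sub]
  rw [integral_sub i3 i1, integral_sub i2 i1, e1]

/-- Translates of a function of bounded variation are Lipschitz in `L¹`. -/
theorem MemBV.exists_integral_translate_le {u : ℝ → ℝ} (hu : MemBV univ u) :
    ∃ C : ℝ, 0 ≤ C ∧ ∀ s > 0, ∫ x, |u (x + s) - u x| ≤ C * s := by
  obtain ⟨C, hC0, hC⟩ := hu.exists_forall_integral_translate_mul_le
  refine ⟨C, hC0, fun s hs => ?_⟩
  have hint : Integrable u := by simpa [integrableOn_univ] using hu.1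
  have hd : Integrable fun x => u (x + s) - u x := (hint.comp_add_right s).sub hint
  -- The sign must be a genuinely measurable function, so it is taken of a measurable
  -- representative.
  set d' := hd.aestronglyMeasurable.mk _ with hd'
  have hdm : Measurable d' := hd.aestronglyMeasurable.stronglyMeasurable_mk.measurable
  have hde : (fun x => u (x + s) - u x) =ᵐ[volume] d' := hd.aestronglyMeasurable.ae_eq_mk
  have key : ∀ n : ℕ, ∫ x in Icc (-(n : ℝ)) n, |u (x + s) - u x| ≤ C * s := by
    intro n
    set χ : ℝ → ℝ := (Icc (-(n : ℝ)) n).indicator fun x => if 0 ≤ d' x then 1 else -1 with hχ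
    have hχm : Measurable χ := Measurable.indicator
      (Measurable.ite (measurableSet_le measurable_const hdm) measurable_const measurable_const)
      measurableSet_Icc
    refine le_trans (le_of_eq ?_) (hC s hs χ hχm ?_ n ?_)
    · rw [← integral_indicator measurableSet_Icc]
      apply integral_congr_ae
      filter_upwards [hde] with x hx
      by_cases h : x ∈ Icc (-(n : ℝ)) n
      · simp only [hχ, indicator_of_mem h, hx]
        split_ifs with h0
        · rw [abs_of_nonneg h0, mul_one]
        · rw [abs_of_neg (not_le.1 h0)]; ring
      · simp [hχ, indicator_of_notMem h]
    · intro x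
      by_cases h : x ∈ Icc (-(n : ℝ)) n
      · simp only [hχ, indicator_of_mem h]
        split_ifs <;> simp
      · simp [hχ, indicator_of_notMem h]
    · intro x hx
      simp [hχ, indicator_of_notMem hx]
  have hU : ⋃ n : ℕ, Icc (-(n : ℝ)) n = univ := by
    rw [eq_univ_iff_forall]
    intro x
    obtain ⟨n, hn⟩ := exists_nat_ge |x|
    exact mem_iUnion.2 ⟨n, abs_le.1 hn⟩
  have hT := tendsto_setIntegral_of_monotone (μ := volume) (s := fun n : ℕ => Icc (-(n : ℝ)) n)
    (f := fun x => |u (x + s) - u x|) (fun _ => measurableSet_Icc)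
    (fun a b hab => Icc_subset_Icc (by simpa using hab) (by simpa using hab))
    hd.abs.integrableOn
  rw [hU, setIntegral_univ] at hT
  exact le_of_tendsto' hT key

/-- The integral of `u` over `(x, x + s)` is minus the integral of `u (y + s) - u y` over `(x, ∞)`,
hence at most `C * s`. Lebesgue differentiation passes from averages to values. -/
theorem MemBV.exists_ae_abs_le {u : ℝ → ℝ} (hu : MemBV univ u) :
    ∃ C : ℝ, ∀ᵐ x, |u x| ≤ C := by
  obtain ⟨C, hC0, hC⟩ := hu.exists_integral_translate_le
  have hint : Integrable u := by simpa [integrableOn_univ] using hu.1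
  refine ⟨C, ?_⟩
  have hA : ∀ s > 0, ∀ x, |fwdAverage u s x| ≤ C := by
    intro s hs x
    have hi := hint.comp_add_right s
    have e : ∫ y in x..x + s, u y = -∫ y in Ioi x, (u (y + s) - u y) := by
      rw [integral_sub hi.integrableOn hint.integrableOn]
      have : ∫ y in Ioi x, u (y + s) = ∫ y in Ioi (x + s), u y := by
        have := (measurePreserving_add_right volume s).setIntegral_preimage_emb
          (measurableEmbedding_addRight s) u (Ioi (x + s))
        rw [← this]
        simp
      rw [this, neg_sub, intervalIntegral.integral_Ioi_sub_Ioi hint.integrableOn (by linarith)]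
    rw [fwdAverage, e, abs_mul, abs_neg, abs_of_pos (inv_pos.2 hs), inv_mul_le_iff₀ hs, mul_comm]
    refine (abs_integral_le_integral_abs).trans (le_trans ?_ (hC s hs))
    exact setIntegral_le_integral (hi.sub hint).abs (Eventually.of_forall fun _ => abs_nonneg _)
  set δ : ℕ → ℝ := fun n => 1 / ((n : ℝ) + 1) with hδ
  have hδp : ∀ n, 0 < δ n := fun n => by positivity
  filter_upwards [tendsto_fwdAverage hint.locallyIntegrable hδp
    tendsto_one_div_add_atTop_nhds_zero_nat] with x hx
  exact le_of_tendsto' hx.abs fun n => hA _ (hδp n) x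

theorem average_mem_Icc {u : ℝ → ℝ} (hu : Integrable u) {p q a b : ℝ} (hpq : p < q)
    (h : ∀ᵐ x, x ∈ Ioo p q → u x ∈ Icc a b) :
    1 / (q - p) * ∫ x in p..q, u x ∈ Icc a b := by
  have hd : 0 < q - p := sub_pos.2 hpq
  rw [intervalIntegral.integral_of_le hpq.le, integral_Ioc_eq_integral_Ioo]
  have h' := (ae_restrict_iff' (measurableSet_Ioo : MeasurableSet (Ioo p q))).2 h
  have hc : ∀ c : ℝ, ∫ x in Ioo p q, c = (q - p) * c := fun c => by
    simp [measureReal_def, Real.volume_Ioo, ENNReal.toReal_ofReal hd.le]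
  have hi : ∀ c : ℝ, IntegrableOn (fun _ => c) (Ioo p q) := fun c =>
    integrableOn_const (by simp)
  constructor
  · have := setIntegral_mono_ae_restrict (hi a) hu.integrableOn (h'.mono fun x hx => hx.1)
    rw [hc] at this
    rw [one_div, le_inv_mul_iff₀ hd]
    exact this
  · have := setIntegral_mono_ae_restrict hu.integrableOn (hi b) (h'.mono fun x hx => hx.2)
    rw [hc] at this
    rw [one_div, inv_mul_le_iff₀ hd]
    exact this

theorem tsum_enorm_intervalIntegral_le {f : ℝ → ℝ} {a s : ℝ} (hs : 0 < s) :
    ∑' j : ℤ, ‖∫ x in (a + j * s)..(a + (j + 1) * s), f x‖ₑ ≤ ∫⁻ x, ‖f x‖ₑ := by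
  have hd := pairwise_disjoint_Ioc_add_zsmul a s
  have e : ∀ j : ℤ, Ioc (a + j • s) (a + (j + 1) • s) = Ioc (a + j * s) (a + (j + 1) * s) := by
    intro j; simp
  calc ∑' j : ℤ, ‖∫ x in (a + j * s)..(a + (j + 1) * s), f x‖ₑ
      ≤ ∑' j : ℤ, ∫⁻ x in Ioc (a + j • s) (a + (j + 1) • s), ‖f x‖ₑ := by
        refine ENNReal.tsum_le_tsum fun j => ?_
        rw [e, intervalIntegral.integral_of_le (by nlinarith)]
        exact enorm_integral_le_lintegral_enorm _
    _ = ∫⁻ x in ⋃ j : ℤ, Ioc (a + j • s) (a + (j + 1) • s), ‖f x‖ₑ :=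
        (lintegral_iUnion (fun _ => measurableSet_Ioc) hd _).symm
    _ ≤ _ := setLIntegral_le_lintegral _ _

/-! ### The initial cell averages -/

namespace SchemeData

variable {D : SchemeData}

/-- Real-valued `essInf` and `essSup` are meaningful only for essentially bounded functions; this is
where the bound on `u0` is needed. -/
theorem ae_essInf_le_le_essSup {u : ℝ → ℝ} {C : ℝ} (hC : ∀ᵐ x, |u x| ≤ C) {S : Set ℝ}
    (hS : MeasurableSet S) :
    ∀ᵐ x, x ∈ S → u x ∈ Icc (essInf u (volume.restrict S)) (essSup u (volume.restrict S)) := by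
  rw [← ae_restrict_iff' hS]
  have h := ae_restrict_of_ae (s := S) hC
  have h1 : IsBoundedUnder (· ≤ ·) (ae (volume.restrict S)) u :=
    ⟨C, eventually_map.2 (h.mono fun x hx => (abs_le.1 hx).2)⟩
  have h2 : IsBoundedUnder (· ≥ ·) (ae (volume.restrict S)) u :=
    ⟨-C, eventually_map.2 (h.mono fun x hx => (abs_le.1 hx).1)⟩
  filter_upwards [ae_essInf_le h2, ae_le_essSup h1] with x a b using ⟨a, b⟩

theorem inRegion_initial (hmu : 0 < D.mu) (hu0 : MemBV univ D.u0) {dt : ℝ} (hdt : 0 < dt) :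
    D.InRegion (D.initial dt) := by
  obtain ⟨C, hC⟩ := hu0.exists_ae_abs_le
  have hint : Integrable D.u0 := by simpa [integrableOn_univ] using hu0.1
  have hdx : 0 < D.dx dt := div_pos hdt hmu
  intro j
  have hlen : D.interface dt (j + 1) - D.interface dt j = D.dx dt := by
    simp [interface]; ring
  have hlt : D.interface dt j < D.interface dt (j + 1) := by linarith
  have hav := fun a b => average_mem_Icc (a := a) (b := b) hint hlt
  rw [hlen] at hav
  change ∀ a b, _ → D.initial dt j ∈ Icc a b at hav
  by_cases hj : j ≤ 0
  · have h := ae_essInf_le_le_essSup hC (measurableSet_Iio (a := D.h0))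
    have hm := hav _ _ (h.mono fun x hx hxj => hx ?_)
    · have e1 : D.lowerBound ≤ _ := min_le_left _ _
      have e2 : _ ≤ D.upperBound := le_max_left _ _
      simp only [shift, if_pos hj, add_zero]
      exact ⟨by linarith [hm.1], hm.2.trans e2⟩
    · refine hxj.2.trans_le ?_
      have : (j : ℝ) ≤ 0 := by exact_mod_cast hj
      simp only [interface]
      push_cast
      nlinarith
  · have h := ae_essInf_le_le_essSup hC (measurableSet_Ioi (a := D.h0))
    have hm := hav _ _ (h.mono fun x hx hxj => hx ?_)
    · have e1 : D.lowerBound ≤ _ := min_le_right _ _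
      have e2 : _ ≤ D.upperBound := le_max_right _ _
      simp only [shift, if_neg hj]
      exact ⟨by linarith [hm.1], by linarith [hm.2]⟩
    · refine lt_of_le_of_lt ?_ hxj.1
      have : (1 : ℝ) ≤ (j : ℝ) := by exact_mod_cast (not_le.1 hj)
      simp only [interface]
      nlinarith

theorem seqVariation_shift_le (hlam : 0 < D.lam) (u : ℤ → ℝ) :
    seqVariation (D.shift u) ≤ seqVariation u + ENNReal.ofReal D.lam := by
  have h : ∀ j, ‖D.shift u (j + 1) - D.shift u j‖ₑ ≤
      ‖u (j + 1) - u j‖ₑ + if j = 0 then ENNReal.ofReal D.lam else 0 := by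
    intro j
    by_cases hj : j = 0
    · subst hj
      have : D.shift u (0 + 1) - D.shift u 0 = (u (0 + 1) - u 0) + D.lam := by
        simp [shift]; ring
      rw [this, if_pos rfl]
      refine (enorm_add_le _ _).trans (le_of_eq ?_)
      rw [Real.enorm_of_nonneg hlam.le]
    · have : D.shift u (j + 1) - D.shift u j = u (j + 1) - u j := by
        simp only [shift]
        split_ifs <;> first | omega | ring
      rw [this, if_neg hj, add_zero]
  calc seqVariation (D.shift u) ≤ _ := ENNReal.tsum_le_tsum h
    _ = _ := by rw [ENNReal.tsum_add, tsum_ite_eq, seqVariation]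

theorem seqVariation_le_shift (hlam : 0 < D.lam) (u : ℤ → ℝ) :
    seqVariation u ≤ seqVariation (D.shift u) + ENNReal.ofReal D.lam := by
  have h : ∀ j, ‖u (j + 1) - u j‖ₑ ≤
      ‖D.shift u (j + 1) - D.shift u j‖ₑ + if j = 0 then ENNReal.ofReal D.lam else 0 := by
    intro j
    by_cases hj : j = 0
    · subst hj
      have : u (0 + 1) - u 0 = (D.shift u (0 + 1) - D.shift u 0) - D.lam := by
        simp [shift]; ring
      rw [this, if_pos rfl]
      refine enorm_sub_le.trans (le_of_eq ?_)
      rw [Real.enorm_of_nonneg hlam.le]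
    · have : D.shift u (j + 1) - D.shift u j = u (j + 1) - u j := by
        simp only [shift]
        split_ifs <;> first | omega | ring
      rw [this, if_neg hj, add_zero]
  calc seqVariation u ≤ _ := ENNReal.tsum_le_tsum h
    _ = _ := by rw [ENNReal.tsum_add, tsum_ite_eq, seqVariation]

theorem exists_seqVariation_initial_le (hmu : 0 < D.mu) (hu0 : MemBV univ D.u0) :
    ∃ V : ℝ, 0 ≤ V ∧ ∀ dt > 0, seqVariation (D.initial dt) ≤ ENNReal.ofReal V := by
  obtain ⟨C, hC0, hC⟩ := hu0.exists_integral_translate_le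
  have hint : Integrable D.u0 := by simpa [integrableOn_univ] using hu0.1
  refine ⟨C, hC0, fun dt hdt => ?_⟩
  have hdx : 0 < D.dx dt := div_pos hdt hmu
  set s := D.dx dt with hs
  have hi := hint.comp_add_right s
  have hd : Integrable fun x => D.u0 (x + s) - D.u0 x := hi.sub hint
  -- Neighbouring averages differ by the average over one cell of `u0 (x + s) - u0 x`. The cells
  -- tile the line, so the variation is at most `s⁻¹ * (C * s)`.
  have e : ∀ j, D.initial dt (j + 1) - D.initial dt j = s⁻¹ *
      ∫ x in (D.h0 - s + j * s)..(D.h0 - s + (j + 1) * s), (D.u0 (x + s) - D.u0 x) := by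
    intro j
    rw [intervalIntegral.integral_sub hi.intervalIntegrable hint.intervalIntegrable,
      intervalIntegral.integral_comp_add_right, mul_sub]
    simp only [initial, interface, one_div, ← hs]
    push_cast
    congr 3 <;> ring_nf
  rw [seqVariation]
  simp_rw [e, enorm_mul]
  rw [ENNReal.tsum_mul_left]
  calc _ ≤ ‖s⁻¹‖ₑ * ∫⁻ x, ‖D.u0 (x + s) - D.u0 x‖ₑ := by
        gcongr
        exact tsum_enorm_intervalIntegral_le hdx
    _ = ‖s⁻¹‖ₑ * ENNReal.ofReal (∫ x, |D.u0 (x + s) - D.u0 x|) := by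
        congr 1
        exact (ofReal_integral_norm_eq_lintegral_enorm hd).symm
    _ ≤ ENNReal.ofReal s⁻¹ * ENNReal.ofReal (C * s) := by
        rw [Real.enorm_of_nonneg (by positivity)]
        gcongr
        exact hC s hdx
    _ = ENNReal.ofReal C := by
        rw [← ENNReal.ofReal_mul (by positivity)]
        congr 1
        field_simp

end SchemeData

/-! ### Translation estimates for step functions -/

theorem enorm_sub_le_tsum_ite (w : ℤ → ℝ) {i k : ℤ} (h : i ≤ k) :
    ‖w k - w i‖ₑ ≤ ∑' j, if i ≤ j ∧ j < k then ‖w (j + 1) - w j‖ₑ else 0 := by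
  induction k, h using Int.leInduction with
  | base => simp
  | succ k hk ih =>
    have e : ∀ j : ℤ, (if i ≤ j ∧ j < k + 1 then ‖w (j + 1) - w j‖ₑ else 0) =
        (if i ≤ j ∧ j < k then ‖w (j + 1) - w j‖ₑ else 0) +
          if j = k then ‖w (j + 1) - w j‖ₑ else 0 := by
      intro j
      split_ifs <;> first | omega | simp
    have e' : w (k + 1) - w i = (w k - w i) + (w (k + 1) - w k) := by ring
    rw [tsum_congr e, ENNReal.tsum_add, tsum_ite_eq, e']
    exact (enorm_add_le _ _).trans (by gcongr)

theorem lintegral_step_translate_le_of_le (w : ℤ → ℝ) {r a b : ℝ} (hr : 0 < r) (hab : a ≤ b) :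
    ∫⁻ x, ‖w ⌊(x - a) / r⌋ - w ⌊(x - b) / r⌋‖ₑ ≤ seqVariation w * ENNReal.ofReal (b - a) := by
  -- At `x` the two translates differ by the jumps lying between their indices. The jump at `j` is
  -- counted exactly on an interval of length `b - a`.
  have h : ∀ x, ‖w ⌊(x - a) / r⌋ - w ⌊(x - b) / r⌋‖ₑ ≤
      ∑' j : ℤ, (Ico (a + (j + 1) * r) (b + (j + 1) * r)).indicator
        (fun _ => ‖w (j + 1) - w j‖ₑ) x := by
    intro x
    refine (enorm_sub_le_tsum_ite w (Int.floor_le_floor (by gcongr))).trans (le_of_eq ?_)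
    refine tsum_congr fun j => ?_
    have h1 : ⌊(x - b) / r⌋ ≤ j ↔ x < b + (j + 1) * r := by
      rw [← Int.lt_add_one_iff, Int.floor_lt, div_lt_iff₀ hr]
      push_cast
      constructor <;> intro h <;> linarith
    have h2 : j < ⌊(x - a) / r⌋ ↔ a + (j + 1) * r ≤ x := by
      rw [← Int.add_one_le_iff, Int.le_floor, le_div_iff₀ hr]
      push_cast
      constructor <;> intro h <;> linarith
    simp only [indicator, mem_Ico, h1, h2, and_comm]
  calc _ ≤ _ := lintegral_mono h
    _ = ∑' j : ℤ, ‖w (j + 1) - w j‖ₑ * ENNReal.ofReal (b - a) := by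
      rw [lintegral_tsum fun j => (measurable_const.indicator measurableSet_Ico).aemeasurable]
      refine tsum_congr fun j => ?_
      rw [lintegral_indicator_const measurableSet_Ico, Real.volume_Ico]
      congr 2; ring
    _ = _ := ENNReal.tsum_mul_right

theorem lintegral_step_translate_le (w : ℤ → ℝ) {r : ℝ} (hr : 0 < r) (a b : ℝ) :
    ∫⁻ x, ‖w ⌊(x - a) / r⌋ - w ⌊(x - b) / r⌋‖ₑ ≤ seqVariation w * ENNReal.ofReal |a - b| := by
  rcases le_total a b with h | h
  · rw [abs_sub_comm, abs_of_nonneg (sub_nonneg.2 h)]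
    exact lintegral_step_translate_le_of_le w hr h
  · rw [abs_of_nonneg (sub_nonneg.2 h)]
    simp_rw [enorm_sub_rev (w ⌊(_ - a) / r⌋)]
    exact lintegral_step_translate_le_of_le w hr h

theorem lintegral_step_le (φ : ℤ → ℝ≥0∞) {r : ℝ} (hr : 0 < r) (a : ℝ) :
    ∫⁻ x, φ ⌊(x - a) / r⌋ ≤ ENNReal.ofReal r * ∑' j, φ j := by
  have h : ∀ x, φ ⌊(x - a) / r⌋ ≤
      ∑' j : ℤ, (Ico (a + j * r) (a + (j + 1) * r)).indicator (fun _ => φ j) x := by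
    intro x
    refine le_trans (le_of_eq ?_) (ENNReal.le_tsum ⌊(x - a) / r⌋)
    rw [indicator_of_mem]
    have h1 := Int.floor_le ((x - a) / r)
    have h2 := Int.lt_floor_add_one ((x - a) / r)
    rw [le_div_iff₀ hr] at h1
    rw [div_lt_iff₀ hr] at h2
    constructor <;> linarith
  calc _ ≤ _ := lintegral_mono h
    _ = ∑' j : ℤ, ENNReal.ofReal r * φ j := by
      rw [lintegral_tsum fun j => (measurable_const.indicator measurableSet_Ico).aemeasurable]
      refine tsum_congr fun j => ?_
      rw [lintegral_indicator_const measurableSet_Ico, Real.volume_Ico, mul_comm]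
      congr 2; ring
    _ = _ := ENNReal.tsum_mul_left

theorem seqVariation_comp_add_one (w : ℤ → ℝ) :
    seqVariation (fun j => w (j + 1)) = seqVariation w :=
  (Equiv.addRight (1 : ℤ)).tsum_eq fun j => ‖w (j + 1) - w j‖ₑ

theorem mul_abs_floor_sub_le {dt s t : ℝ} (hdt : 0 < dt) (hs : 0 ≤ s) (ht : 0 ≤ t) :
    dt * |(⌊t / dt⌋₊ : ℝ) - ⌊s / dt⌋₊| ≤ |t - s| + dt := by
  have h1 := Nat.floor_le (div_nonneg ht hdt.le)
  have h2 := Nat.lt_floor_add_one (t / dt)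
  have h3 := Nat.floor_le (div_nonneg hs hdt.le)
  have h4 := Nat.lt_floor_add_one (s / dt)
  rw [le_div_iff₀ hdt] at h1 h3
  rw [div_lt_iff₀ hdt] at h2 h4
  rw [← abs_of_pos hdt, ← abs_mul, abs_of_pos hdt]
  apply abs_le.2
  constructor
  · linarith [neg_abs_le (t - s)]
  · linarith [le_abs_self (t - s)]

/-! ### Uniform estimates for the approximate solutions -/

namespace SchemeData

variable (D : SchemeData)

/-- The approximate particle velocity. -/
noncomputable def velApprox (dt t : ℝ) : ℝ := (D.state dt ⌊t / dt⌋₊).2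

theorem measurable_velApprox (dt : ℝ) : Measurable (D.velApprox dt) :=
  (Measurable.of_discrete (f := fun n : ℕ => (D.state dt n).2)).comp
    (Nat.measurable_floor.comp (measurable_id.div_const dt))

theorem measurable_hApprox (dt : ℝ) : Measurable (D.hApprox dt) := by
  have hf : Measurable fun t : ℝ => ⌊t / dt⌋₊ :=
    Nat.measurable_floor.comp (measurable_id.div_const dt)
  have h1 : Measurable fun t : ℝ =>
      D.h0 + dt * ∑ m ∈ Finset.range ⌊t / dt⌋₊, (D.state dt m).2 :=
    (Measurable.of_discrete (f := fun n : ℕ =>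
      D.h0 + dt * ∑ m ∈ Finset.range n, (D.state dt m).2)).comp hf
  have h2 : Measurable fun t : ℝ => (⌊t / dt⌋₊ : ℝ) :=
    (Measurable.of_discrete (f := fun n : ℕ => (n : ℝ))).comp hf
  exact h1.add ((D.measurable_velApprox dt).mul (measurable_id.sub (h2.mul_const dt)))

theorem measurable_uApprox (dt : ℝ) : Measurable (D.uApprox dt) := by
  have h1 : Measurable fun p : ℝ × ℝ => ⌊p.1 / dt⌋₊ :=
    Nat.measurable_floor.comp (measurable_fst.div_const dt)
  have h2 : Measurable fun p : ℝ × ℝ => ⌊(p.2 - D.hApprox dt p.1) / D.dx dt⌋ :=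
    Int.measurable_floor.comp
      ((measurable_snd.sub ((D.measurable_hApprox dt).comp measurable_fst)).div_const _)
  exact (Measurable.of_discrete (f := fun q : ℕ × ℤ => (D.state dt q.1).1 (q.2 + 1))).comp
    (h1.prodMk h2)

variable {D}

/-- A bound of the particle velocities. -/
noncomputable def velBound (D : SchemeData) : ℝ := |min D.lowerBound D.v0| + |max D.upperBound D.v0|

theorem abs_le_velBound {v : ℝ} (hv : v ∈ D.velInterval) : |v| ≤ D.velBound := by
  rw [velBound]
  refine (abs_le_max_abs_abs hv.1 hv.2).trans (max_le ?_ ?_)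
  · linarith [abs_nonneg (max D.upperBound D.v0)]
  · linarith [abs_nonneg (min D.lowerBound D.v0)]

section

variable {K dt : ℝ} (hdt : 0 < dt) (hB : ∀ n, D.StepBounds K dt n)
include hB

theorem abs_velApprox_le (t : ℝ) : |D.velApprox dt t| ≤ D.velBound :=
  abs_le_velBound (hB _).vel_mem

theorem abs_uApprox_le (hlam : 0 < D.lam) (p : ℝ × ℝ) :
    |D.uApprox dt p| ≤ |D.lowerBound| + |D.upperBound| := by
  have h := (hB ⌊p.1 / dt⌋₊).inRegion.mem_Icc hlam
    (⌊(p.2 - D.hApprox dt p.1) / D.dx dt⌋ + 1)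
  refine (abs_le_max_abs_abs h.1 h.2).trans (max_le ?_ ?_)
  · linarith [abs_nonneg D.upperBound]
  · linarith [abs_nonneg D.lowerBound]

include hdt

omit hB in
theorem integral_velApprox_cell {n : ℕ} {t : ℝ} (h1 : n * dt ≤ t) (h2 : t ≤ (n + 1) * dt) :
    ∫ s in (n * dt)..t, D.velApprox dt s = (D.state dt n).2 * (t - n * dt) := by
  rw [intervalIntegral.integral_of_le h1, integral_Ioc_eq_integral_Ioo,
    setIntegral_congr_fun (g := fun _ => (D.state dt n).2) measurableSet_Ioo]
  · rw [setIntegral_const, measureReal_def, Real.volume_Ioo,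
      ENNReal.toReal_ofReal (sub_nonneg.2 h1), smul_eq_mul, mul_comm]
  · intro s hs
    have : ⌊s / dt⌋₊ = n := by
      rw [Nat.floor_eq_iff (div_nonneg ((by positivity : 0 ≤ n * dt).trans hs.1.le) hdt.le)]
      constructor
      · rw [le_div_iff₀ hdt]; exact hs.1.le
      · rw [div_lt_iff₀ hdt]; exact hs.2.trans_le h2
    simp only [velApprox, this]

theorem hApprox_eq_integral {t : ℝ} (ht : 0 ≤ t) :
    D.hApprox dt t = D.h0 + ∫ s in (0 : ℝ)..t, D.velApprox dt s := by
  have hi := intervalIntegrable_of_abs_le (D.measurable_velApprox dt) (abs_velApprox_le hB)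
  have hn : ∀ n : ℕ, ∫ s in (0 : ℝ)..(n * dt), D.velApprox dt s =
      dt * ∑ m ∈ Finset.range n, (D.state dt m).2 := by
    intro n
    induction n with
    | zero => simp
    | succ n ih =>
      rw [← intervalIntegral.integral_add_adjacent_intervals (hi 0 (n * dt)) (hi _ _), ih,
        Finset.sum_range_succ, integral_velApprox_cell hdt]
      · push_cast; ring
      · push_cast; nlinarith
      · push_cast; exact le_rfl
  have h1 := Nat.floor_le (div_nonneg ht hdt.le)
  have h2 := Nat.lt_floor_add_one (t / dt)
  rw [le_div_iff₀ hdt] at h1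
  rw [div_lt_iff₀ hdt] at h2
  rw [← intervalIntegral.integral_add_adjacent_intervals (hi 0 (⌊t / dt⌋₊ * dt)) (hi _ _), hn,
    integral_velApprox_cell hdt h1 h2.le, hApprox]
  ring

theorem abs_hApprox_sub_le {s t : ℝ} (hs : 0 ≤ s) (ht : 0 ≤ t) :
    |D.hApprox dt t - D.hApprox dt s| ≤ D.velBound * |t - s| := by
  have hi := intervalIntegrable_of_abs_le (D.measurable_velApprox dt) (abs_velApprox_le hB)
  rw [hApprox_eq_integral hdt hB hs, hApprox_eq_integral hdt hB ht, add_sub_add_left_eq_sub,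
    intervalIntegral.integral_interval_sub_left (hi _ _) (hi _ _)]
  exact abs_integral_le_of_abs_le (abs_velApprox_le hB) _ _

theorem abs_velApprox_sub_le (hK : 0 ≤ K) {s t : ℝ} (hs : 0 ≤ s) (ht : 0 ≤ t) :
    |D.velApprox dt t - D.velApprox dt s| ≤ K * (|t - s| + dt) := by
  have key : ∀ n k : ℕ, |(D.state dt (n + k)).2 - (D.state dt n).2| ≤ k * (K * dt) := by
    intro n k
    induction k with
    | zero => simp
    | succ k ih =>
      have := (hB (n + k)).vel_le
      have h := abs_sub_le (D.state dt (n + k + 1)).2 (D.state dt (n + k)).2 (D.state dt n).2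
      rw [← add_assoc]
      push_cast
      linarith
  have key' : ∀ n m : ℕ, |(D.state dt n).2 - (D.state dt m).2| ≤
      |(n : ℝ) - m| * (K * dt) := by
    intro n m
    rcases le_total m n with h | h
    · obtain ⟨k, rfl⟩ := Nat.exists_eq_add_of_le h
      have := key m k
      push_cast
      rwa [add_sub_cancel_left, abs_of_nonneg (Nat.cast_nonneg k : (0 : ℝ) ≤ k)]
    · obtain ⟨k, rfl⟩ := Nat.exists_eq_add_of_le h
      have := key n k
      push_cast
      rwa [abs_sub_comm, sub_add_cancel_left, abs_neg,
        abs_of_nonneg (Nat.cast_nonneg k : (0 : ℝ) ≤ k)]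
  calc _ ≤ |(⌊t / dt⌋₊ : ℝ) - ⌊s / dt⌋₊| * (K * dt) := key' _ _
    _ = K * (dt * |(⌊t / dt⌋₊ : ℝ) - ⌊s / dt⌋₊|) := by ring
    _ ≤ _ := by gcongr; exact mul_abs_floor_sub_le hdt hs ht

variable {V : ℝ} (hV : seqVariation (D.shift (D.initial dt)) ≤ ENNReal.ofReal V)
include hV

omit hdt in
theorem seqVariation_state_le (hlam : 0 < D.lam) (hV0 : 0 ≤ V) (n : ℕ) :
    seqVariation (fun j => (D.state dt n).1 (j + 1)) ≤ ENNReal.ofReal (V + D.lam) := by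
  rw [seqVariation_comp_add_one, ENNReal.ofReal_add hV0 hlam.le]
  refine (seqVariation_le_shift hlam _).trans ?_
  gcongr
  exact (hB n).variation_le.trans hV

omit hdt in
theorem tsum_state_sub_le (n m : ℕ) :
    ∑' j, ‖(D.state dt n).1 j - (D.state dt m).1 j‖ₑ ≤
      ENNReal.ofReal |(n : ℝ) - m| * ENNReal.ofReal V := by
  have key : ∀ n k : ℕ, ∑' j, ‖(D.state dt (n + k)).1 j - (D.state dt n).1 j‖ₑ ≤
      ENNReal.ofReal k * ENNReal.ofReal V := by
    intro n k
    induction k with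
    | zero => simp
    | succ k ih =>
      calc _ ≤ ∑' j, (‖(D.state dt (n + k + 1)).1 j - (D.state dt (n + k)).1 j‖ₑ +
            ‖(D.state dt (n + k)).1 j - (D.state dt n).1 j‖ₑ) := by
            refine ENNReal.tsum_le_tsum fun j => ?_
            rw [← add_assoc, ← sub_add_sub_cancel _ ((D.state dt (n + k)).1 j)]
            exact enorm_add_le _ _
        _ ≤ ENNReal.ofReal V + ENNReal.ofReal k * ENNReal.ofReal V := by
            rw [ENNReal.tsum_add]
            exact add_le_add ((hB (n + k)).time_le.trans hV) ih
        _ = _ := by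
            push_cast
            rw [ENNReal.ofReal_add (by positivity) zero_le_one, ENNReal.ofReal_one]
            ring
  rcases le_total m n with h | h
  · obtain ⟨k, rfl⟩ := Nat.exists_eq_add_of_le h
    have := key m k
    push_cast
    rwa [add_sub_cancel_left, abs_of_nonneg (Nat.cast_nonneg k)]
  · obtain ⟨k, rfl⟩ := Nat.exists_eq_add_of_le h
    have := key n k
    push_cast
    simp_rw [enorm_sub_rev ((D.state dt n).1 _)]
    rwa [sub_add_cancel_left, abs_neg, abs_of_nonneg (Nat.cast_nonneg k)]

theorem lintegral_uApprox_space_le (hlam : 0 < D.lam) (hmu : 0 < D.mu) (hV0 : 0 ≤ V)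
    (t y : ℝ) :
    ∫⁻ x, ‖D.uApprox dt (t, x + y) - D.uApprox dt (t, x)‖ₑ ≤
      ENNReal.ofReal ((V + D.lam) * |y|) := by
  have hdx : 0 < D.dx dt := div_pos hdt hmu
  have := lintegral_step_translate_le (fun j => (D.state dt ⌊t / dt⌋₊).1 (j + 1)) hdx
    (D.hApprox dt t - y) (D.hApprox dt t)
  rw [sub_sub_cancel_left, abs_neg] at this
  rw [ENNReal.ofReal_mul (by positivity)]
  refine le_trans (le_of_eq ?_) (this.trans (by
    gcongr
    exact seqVariation_state_le hB hV hlam hV0 _))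
  simp only [uApprox, sub_sub_eq_add_sub]

theorem lintegral_uApprox_time_le (hlam : 0 < D.lam) (hmu : 0 < D.mu) (hV0 : 0 ≤ V)
    {s t : ℝ} (hs : 0 ≤ s) (ht : 0 ≤ t) :
    ∫⁻ x, ‖D.uApprox dt (t, x) - D.uApprox dt (s, x)‖ₑ ≤
      ENNReal.ofReal (((V + D.lam) * D.velBound + V / D.mu) * (|t - s| + dt)) := by
  have hdx : 0 < D.dx dt := div_pos hdt hmu
  have hvb : 0 ≤ D.velBound := by rw [velBound]; positivity
  set n := ⌊t / dt⌋₊ with hn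
  set m := ⌊s / dt⌋₊ with hm
  have hmid : Measurable fun x => ‖(D.state dt n).1 (⌊(x - D.hApprox dt t) / D.dx dt⌋ + 1) -
      (D.state dt n).1 (⌊(x - D.hApprox dt s) / D.dx dt⌋ + 1)‖ₑ := by
    have hmf : ∀ a : ℝ, Measurable fun x => (D.state dt n).1 (⌊(x - a) / D.dx dt⌋ + 1) :=
      fun a => (Measurable.of_discrete (f := fun j : ℤ => (D.state dt n).1 (j + 1))).comp
        (Int.measurable_floor.comp ((measurable_id.sub_const a).div_const _))
    exact ((hmf _).sub (hmf _)).enorm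
  -- Insert the values at time `t` on the mesh at time `s`. The first term is a displacement of the
  -- mesh, paid for by the variation in space; the second is the change of the values over `|n - m|`
  -- steps.
  calc _ ≤ ∫⁻ x, (‖(D.state dt n).1 (⌊(x - D.hApprox dt t) / D.dx dt⌋ + 1) -
            (D.state dt n).1 (⌊(x - D.hApprox dt s) / D.dx dt⌋ + 1)‖ₑ +
          ‖(D.state dt n).1 (⌊(x - D.hApprox dt s) / D.dx dt⌋ + 1) -
            (D.state dt m).1 (⌊(x - D.hApprox dt s) / D.dx dt⌋ + 1)‖ₑ) := by
        refine lintegral_mono fun x => ?_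
        simp only [uApprox, ← hn, ← hm]
        refine le_trans (le_of_eq ?_) (enorm_add_le _ _)
        rw [sub_add_sub_cancel]
    _ = (∫⁻ x, ‖(D.state dt n).1 (⌊(x - D.hApprox dt t) / D.dx dt⌋ + 1) -
            (D.state dt n).1 (⌊(x - D.hApprox dt s) / D.dx dt⌋ + 1)‖ₑ) +
          ∫⁻ x, ‖(D.state dt n).1 (⌊(x - D.hApprox dt s) / D.dx dt⌋ + 1) -
            (D.state dt m).1 (⌊(x - D.hApprox dt s) / D.dx dt⌋ + 1)‖ₑ :=
        lintegral_add_left hmid _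
    _ ≤ ENNReal.ofReal ((V + D.lam) * (D.velBound * |t - s|)) +
          ENNReal.ofReal (D.dx dt * (|(n : ℝ) - m| * V)) := by
        gcongr
        · refine (lintegral_step_translate_le (fun j => (D.state dt n).1 (j + 1)) hdx _ _).trans ?_
          rw [ENNReal.ofReal_mul (by positivity)]
          gcongr
          · exact seqVariation_state_le hB hV hlam hV0 _
          · exact abs_hApprox_sub_le hdt hB hs ht
        · refine (lintegral_step_le (fun j => ‖(D.state dt n).1 (j + 1) -
            (D.state dt m).1 (j + 1)‖ₑ) hdx _).trans ?_
          rw [ENNReal.ofReal_mul hdx.le, ENNReal.ofReal_mul (abs_nonneg _)]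
          gcongr
          refine le_trans (le_of_eq ?_) (tsum_state_sub_le hB hV n m)
          exact (Equiv.addRight (1 : ℤ)).tsum_eq fun j =>
            ‖(D.state dt n).1 j - (D.state dt m).1 j‖ₑ
    _ ≤ _ := by
        rw [← ENNReal.ofReal_add (by positivity) (by positivity)]
        apply ENNReal.ofReal_le_ofReal
        have h1 := mul_abs_floor_sub_le hdt hs ht
        rw [← hn, ← hm] at h1
        have h2 : D.dx dt * (|(n : ℝ) - m| * V) = V / D.mu * (dt * |(n : ℝ) - m|) := by
          rw [dx]; ring
        have h3 : (V + D.lam) * (D.velBound * |t - s|) ≤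
            (V + D.lam) * D.velBound * (|t - s| + dt) := by
          rw [mul_assoc]
          gcongr
          linarith
        rw [h2, add_mul ((V + D.lam) * D.velBound)]
        exact add_le_add h3 (mul_le_mul_of_nonneg_left h1 (by positivity))

end

end SchemeData

/-! ### Compactness of uniformly `BV` sequences in `L¹` -/

/-- Diagonal extraction for countably many bounded real sequences. -/
theorem exists_subseq_forall_tendsto {ι : Type*} [Countable ι] {a : ℕ → ι → ℝ} {b : ι → ℝ}
    (h : ∀ k i, |a k i| ≤ b i) :
    ∃ σ : ℕ → ℕ, StrictMono σ ∧ ∃ l : ι → ℝ, ∀ i, Tendsto (fun k => a (σ k) i) atTop (𝓝 (l i)) := by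
  have hc : IsCompact (univ.pi fun i => Icc (-b i) (b i)) := isCompact_univ_pi fun i => isCompact_Icc
  obtain ⟨l, -, σ, hσ, hl⟩ := hc.tendsto_subseq (x := a) fun k i _ => abs_le.1 (h k i)
  exact ⟨σ, hσ, l, fun i => (tendsto_pi_nhds.1 hl) i⟩

theorem tendsto_zero_of_enorm {ι : Type*} {l : Filter ι} {f : ι → ℝ}
    (h : Tendsto (fun i => ‖f i‖ₑ) l (𝓝 0)) : Tendsto f l (𝓝 0) := by
  rw [tendsto_iff_edist_tendsto_0]
  simpa only [edist_zero_right] using h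

theorem tendsto_enorm_sub_of_tendsto {a : ℕ → ℝ} {l : ℝ} (h : Tendsto a atTop (𝓝 l)) :
    Tendsto (fun p : ℕ × ℕ => ‖a p.1 - a p.2‖ₑ) (atTop ×ˢ atTop) (𝓝 0) := by
  have : Tendsto (fun p : ℕ × ℕ => a p.1 - a p.2) (atTop ×ˢ atTop) (𝓝 (l - l)) :=
    (h.comp tendsto_fst).sub (h.comp tendsto_snd)
  simpa using this.enorm

/-- Convergence to `0` at the rationals, together with equicontinuity up to an error that tends to
`0`, gives convergence everywhere. -/
theorem tendsto_zero_of_tendsto_rat {ι : Type*} {l : Filter ι} {d : ι → ℝ → ℝ≥0∞} {e : ι → ℝ}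
    {L : ℝ} {S : Set ℝ} (hS : IsUpperSet S) (he : Tendsto e l (𝓝 0))
    (hd : ∀ p, ∀ s ∈ S, ∀ t ∈ S, d p t ≤ d p s + ENNReal.ofReal (L * (|t - s| + e p)))
    (hq : ∀ q : ℚ, (q : ℝ) ∈ S → Tendsto (fun p => d p q) l (𝓝 0)) {t : ℝ} (ht : t ∈ S) :
    Tendsto (fun p => d p t) l (𝓝 0) := by
  rw [ENNReal.tendsto_nhds_zero]
  intro ε hε
  have h1 : Tendsto (fun s => ENNReal.ofReal (L * |t - s|)) (𝓝 t) (𝓝 0) := by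
    have : Continuous fun s => ENNReal.ofReal (L * |t - s|) :=
      ENNReal.continuous_ofReal.comp (by fun_prop)
    simpa using this.tendsto t
  obtain ⟨δ, hδ, hδ'⟩ := Metric.eventually_nhds_iff.1 (h1.eventually_lt_const hε)
  obtain ⟨q, hq1, hq2⟩ := exists_rat_btwn (show t < t + δ by linarith)
  have hqS : (q : ℝ) ∈ S := hS hq1.le ht
  have h2 : ENNReal.ofReal (L * |t - q|) < ε := by
    apply hδ'
    rw [Real.dist_eq, abs_of_pos (by linarith)]
    linarith
  have h3 : Tendsto (fun p => d p q + ENNReal.ofReal (L * (|t - q| + e p))) l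
      (𝓝 (0 + ENNReal.ofReal (L * (|t - q| + 0)))) :=
    (hq q hqS).add (ENNReal.tendsto_ofReal ((he.const_add _).const_mul L))
  rw [zero_add, add_zero] at h3
  filter_upwards [h3.eventually_lt_const h2] with p hp
  exact (hd p q hqS t ht).trans hp.le

theorem lintegral_sub_fwdAverage_le {f : ℝ → ℝ} {B W δ : ℝ} (hm : Measurable f)
    (hB : ∀ x, |f x| ≤ B) (hδ : 0 < δ) (hW0 : 0 ≤ W)
    (hW : ∀ y, ∫⁻ x, ‖f (x + y) - f x‖ₑ ≤ ENNReal.ofReal (W * |y|)) :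
    ∫⁻ x, ‖fwdAverage f δ x - f x‖ₑ ≤ ENNReal.ofReal (W * δ) := by
  have h1 : ∀ x, ‖fwdAverage f δ x - f x‖ₑ ≤
      ENNReal.ofReal δ⁻¹ * ∫⁻ y in Ioc 0 δ, ‖f (x + y) - f x‖ₑ := by
    intro x
    have e : fwdAverage f δ x - f x = δ⁻¹ * ∫ y in (0 : ℝ)..δ, (f (x + y) - f x) := by
      have hi : IntervalIntegrable (fun y => f (x + y)) volume 0 δ :=
        intervalIntegrable_of_abs_le (hm.comp (measurable_const_add x)) (fun y => hB _) _ _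
      rw [intervalIntegral.integral_sub hi intervalIntegrable_const,
        intervalIntegral.integral_comp_add_left, intervalIntegral.integral_const, fwdAverage,
        add_zero, sub_zero, smul_eq_mul, mul_sub, inv_mul_cancel_left₀ hδ.ne']
    rw [e, enorm_mul, Real.enorm_of_nonneg (by positivity),
      intervalIntegral.integral_of_le hδ.le]
    gcongr
    exact enorm_integral_le_lintegral_enorm _
  have hmeas : Measurable fun p : ℝ × ℝ => ‖f (p.1 + p.2) - f p.1‖ₑ :=
    ((hm.comp (measurable_fst.add measurable_snd)).sub (hm.comp measurable_fst)).enorm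
  calc _ ≤ ∫⁻ x, ENNReal.ofReal δ⁻¹ * ∫⁻ y in Ioc 0 δ, ‖f (x + y) - f x‖ₑ := lintegral_mono h1
    _ = ENNReal.ofReal δ⁻¹ * ∫⁻ x, ∫⁻ y in Ioc 0 δ, ‖f (x + y) - f x‖ₑ :=
      lintegral_const_mul _ hmeas.lintegral_prod_right'
    -- By Tonelli the error is an average of `L¹` norms of translation differences with `0 < y ≤ δ`.
    _ = ENNReal.ofReal δ⁻¹ * ∫⁻ y in Ioc 0 δ, ∫⁻ x, ‖f (x + y) - f x‖ₑ := by
      rw [lintegral_lintegral_swap]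
      exact hmeas.aemeasurable
    _ ≤ ENNReal.ofReal δ⁻¹ * ∫⁻ y in Ioc 0 δ, ENNReal.ofReal (W * δ) := by
      gcongr ENNReal.ofReal δ⁻¹ * ?_
      refine setLIntegral_mono measurable_const fun y hy => (hW y).trans ?_
      rw [abs_of_pos hy.1]
      apply ENNReal.ofReal_le_ofReal
      exact mul_le_mul_of_nonneg_left hy.2 hW0
    _ = ENNReal.ofReal (W * δ) := by
      rw [setLIntegral_const, Real.volume_Ioc, sub_zero, ← ENNReal.ofReal_mul (by positivity),
        ← ENNReal.ofReal_mul (by positivity)]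
      congr 1
      field_simp

/-- A finite measure on `ℝ` with a positive continuous density that is at most `1`. -/
noncomputable def cauchyWeight : Measure ℝ :=
  volume.withDensity fun x => ENNReal.ofReal (1 + x ^ 2)⁻¹

instance : IsFiniteMeasure cauchyWeight :=
  isFiniteMeasure_withDensity_ofReal integrable_inv_one_add_sq.2

theorem measurable_cauchyDensity : Measurable fun x : ℝ => ENNReal.ofReal (1 + x ^ 2)⁻¹ := by
  fun_prop

theorem cauchyWeight_le : cauchyWeight ≤ volume := by
  have := withDensity_mono (μ := (volume : Measure ℝ))
    (f := fun x => ENNReal.ofReal (1 + x ^ 2)⁻¹) (g := 1) (Eventually.of_forall fun x => by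
      simp only [Pi.one_apply, ENNReal.ofReal_le_one]
      apply inv_le_one_of_one_le₀
      nlinarith [sq_nonneg x])
  rwa [withDensity_one] at this

/-- The weight makes constants integrable, as dominated convergence requires, and stays comparable
with Lebesgue measure on bounded sets. One complete `L¹` space thus accounts for all of `L¹_loc`. -/
theorem restrict_Icc_le_cauchyWeight (R : ℝ) :
    volume.restrict (Icc (-R) R) ≤ ENNReal.ofReal (1 + R ^ 2) • cauchyWeight := by
  intro s
  rw [Measure.smul_apply, smul_eq_mul, cauchyWeight]
  calc volume.restrict (Icc (-R) R) s
      = ∫⁻ x in s, 1 ∂(volume.restrict (Icc (-R) R)) := by simp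
    _ ≤ ∫⁻ x in s, ENNReal.ofReal (1 + R ^ 2) * ENNReal.ofReal (1 + x ^ 2)⁻¹
          ∂(volume.restrict (Icc (-R) R)) := by
        refine lintegral_mono_ae (ae_restrict_of_ae ?_)
        filter_upwards [ae_restrict_mem measurableSet_Icc] with x hx
        rw [← ENNReal.ofReal_mul (by positivity), ENNReal.one_le_ofReal, ← div_eq_mul_inv,
          le_div_iff₀ (by positivity)]
        nlinarith [hx.1, hx.2]
    _ ≤ ∫⁻ x in s, ENNReal.ofReal (1 + R ^ 2) * ENNReal.ofReal (1 + x ^ 2)⁻¹ :=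
        lintegral_mono' (Measure.restrict_mono_measure Measure.restrict_le_self s) le_rfl
    _ = ENNReal.ofReal (1 + R ^ 2) * ∫⁻ x in s, ENNReal.ofReal (1 + x ^ 2)⁻¹ :=
        lintegral_const_mul _ measurable_cauchyDensity
    _ ≤ _ := by
        gcongr
        exact withDensity_apply_le _ _

/-- A sequence of functions of `(t, x)` that is uniformly bounded, of uniformly bounded variation
in `x`, and Lipschitz in time with values in `L¹` up to an error `ε k`. -/
structure UniformBV (U : ℕ → ℝ × ℝ → ℝ) (ε : ℕ → ℝ) (B V C : ℝ) : Prop where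
  nonneg_V : 0 ≤ V
  nonneg_C : 0 ≤ C
  nonneg_eps : ∀ k, 0 ≤ ε k
  tendsto_eps : Tendsto ε atTop (𝓝 0)
  measurable : ∀ k, Measurable (U k)
  abs_le : ∀ k p, |U k p| ≤ B
  space_le : ∀ k t y, ∫⁻ x, ‖U k (t, x + y) - U k (t, x)‖ₑ ≤ ENNReal.ofReal (V * |y|)
  time_le : ∀ k, ∀ s ≥ 0, ∀ t ≥ 0,
    ∫⁻ x, ‖U k (t, x) - U k (s, x)‖ₑ ≤ ENNReal.ofReal (C * (|t - s| + ε k))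

/-- The measure in which the compactness theorem holds. -/
noncomputable def halfPlaneWeight : Measure (ℝ × ℝ) :=
  (cauchyWeight.restrict (Ici 0)).prod cauchyWeight

instance : IsFiniteMeasure halfPlaneWeight := by
  unfold halfPlaneWeight; infer_instance

theorem exists_restrict_le_halfPlaneWeight {K : Set (ℝ × ℝ)} (hK : Bornology.IsBounded K)
    (hK0 : K ⊆ Ici 0 ×ˢ univ) :
    ∃ c : ℝ≥0∞, c ≠ ⊤ ∧ volume.restrict K ≤ c • halfPlaneWeight := by
  obtain ⟨R, hR⟩ := hK.subset_closedBall 0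
  have hsub : K ⊆ (Icc (-R) R ∩ Ici 0) ×ˢ Icc (-R) R := by
    intro p hp
    have h1 := hR hp
    rw [mem_closedBall_zero_iff, Prod.norm_def, max_le_iff, Real.norm_eq_abs, Real.norm_eq_abs,
      abs_le, abs_le] at h1
    exact ⟨⟨h1.1, (hK0 hp).1⟩, h1.2⟩
  set c := ENNReal.ofReal (1 + R ^ 2) with hc
  refine ⟨c * c, ENNReal.mul_ne_top ENNReal.ofReal_ne_top ENNReal.ofReal_ne_top, ?_⟩
  calc volume.restrict K ≤ volume.restrict ((Icc (-R) R ∩ Ici 0) ×ˢ Icc (-R) R) :=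
        Measure.restrict_mono_set _ hsub
    _ = (volume.restrict (Icc (-R) R ∩ Ici 0)).prod (volume.restrict (Icc (-R) R)) := by
        rw [Measure.prod_restrict, Measure.volume_eq_prod]
    _ ≤ (c • cauchyWeight.restrict (Ici 0)).prod (c • cauchyWeight) := by
        refine Measure.prod_mono ?_ (restrict_Icc_le_cauchyWeight R)
        rw [inter_comm, ← Measure.restrict_restrict measurableSet_Ici, ← Measure.restrict_smul]
        exact Measure.restrict_mono_measure (restrict_Icc_le_cauchyWeight R) _
    _ = (c * c) • halfPlaneWeight := by
        rw [Measure.prod_smul_left, Measure.prod_smul_right, smul_smul, halfPlaneWeight]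

namespace UniformBV

variable {U : ℕ → ℝ × ℝ → ℝ} {ε : ℕ → ℝ} {B V C : ℝ}

theorem comp (h : UniformBV U ε B V C) {σ : ℕ → ℕ} (hσ : StrictMono σ) :
    UniformBV (fun k => U (σ k)) (fun k => ε (σ k)) B V C where
  nonneg_V := h.nonneg_V
  nonneg_C := h.nonneg_C
  nonneg_eps _ := h.nonneg_eps _
  tendsto_eps := h.tendsto_eps.comp hσ.tendsto_atTop
  measurable _ := h.measurable _
  abs_le _ := h.abs_le _
  space_le _ := h.space_le _
  time_le _ := h.time_le _

theorem abs_sub_le (h : UniformBV U ε B V C) (p : ℕ × ℕ) (z : ℝ × ℝ) :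
    |U p.1 z - U p.2 z| ≤ 2 * B :=
  (abs_sub _ _).trans (by linarith [h.abs_le p.1 z, h.abs_le p.2 z])

theorem enorm_sub_le (h : UniformBV U ε B V C) (p : ℕ × ℕ) (z : ℝ × ℝ) :
    ‖U p.1 z - U p.2 z‖ₑ ≤ ENNReal.ofReal (2 * B) := by
  rw [Real.enorm_eq_ofReal_abs]
  exact ENNReal.ofReal_le_ofReal (h.abs_sub_le p z)

theorem measurable_slice (h : UniformBV U ε B V C) (k : ℕ) (t : ℝ) :
    Measurable fun x => U k (t, x) :=
  (h.measurable k).comp measurable_prodMk_left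

theorem exists_subseq_tendsto_integral (h : UniformBV U ε B V C) :
    ∃ σ : ℕ → ℕ, StrictMono σ ∧ ∀ q r : ℚ, ∃ l : ℝ,
      Tendsto (fun k => ∫ x in (0 : ℝ)..r, U (σ k) (q, x)) atTop (𝓝 l) := by
  obtain ⟨σ, hσ, l, hl⟩ := exists_subseq_forall_tendsto
    (a := fun k (i : ℚ × ℚ) => ∫ x in (0 : ℝ)..i.2, U k (i.1, x)) (b := fun i => B * |i.2 - 0|)
    fun k i => by
      simpa using abs_integral_le_of_abs_le (fun x => h.abs_le k (i.1, x)) 0 i.2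
  exact ⟨σ, hσ, fun q r => ⟨l (q, r), hl (q, r)⟩⟩

variable (h : UniformBV U ε B V C)
  (hl : ∀ q r : ℚ, ∃ l : ℝ, Tendsto (fun k => ∫ x in (0 : ℝ)..r, U k (q, x)) atTop (𝓝 l))
include h hl

theorem tendsto_integral_sub (q : ℚ) (r : ℝ) :
    Tendsto (fun p : ℕ × ℕ => ∫ x in (0 : ℝ)..r, (U p.1 (q, x) - U p.2 (q, x)))
      (atTop ×ˢ atTop) (𝓝 0) := by
  have hi : ∀ k a b, IntervalIntegrable (fun x => U k (q, x)) volume a b := fun k =>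
    intervalIntegrable_of_abs_le (h.measurable_slice k q) fun x => h.abs_le k _
  apply tendsto_zero_of_enorm
  refine tendsto_zero_of_tendsto_rat (S := univ)
    (d := fun (p : ℕ × ℕ) r => ‖∫ x in (0 : ℝ)..r, (U p.1 (q, x) - U p.2 (q, x))‖ₑ)
    (e := fun _ => 0) (L := 2 * B) isUpperSet_univ tendsto_const_nhds ?_ ?_ (mem_univ r)
  · intro p s _ t _
    have hi' : ∀ a b, IntervalIntegrable (fun x => U p.1 (q, x) - U p.2 (q, x)) volume a b :=
      fun a b => (hi _ _ _).sub (hi _ _ _)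
    rw [← intervalIntegral.integral_add_adjacent_intervals (hi' 0 s) (hi' s t)]
    refine (enorm_add_le _ _).trans ?_
    gcongr
    rw [Real.enorm_eq_ofReal_abs, add_zero]
    exact ENNReal.ofReal_le_ofReal
      (abs_integral_le_of_abs_le (fun x => h.abs_sub_le p (q, x)) s t)
  · intro r _
    obtain ⟨l, hl⟩ := hl q r
    simpa only [intervalIntegral.integral_sub (hi _ _ _) (hi _ _ _)] using
      tendsto_enorm_sub_of_tendsto hl

/-- Averages over `(x, x + δ)` are difference quotients of primitives, so they tend to `0` pointwise
and, by domination, in the weighted `L¹`. The variation bound puts each difference within `2 * V *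
δ` of its average, uniformly in the pair of indices. -/
theorem tendsto_lintegral_sub_rat {q : ℚ} :
    Tendsto (fun p : ℕ × ℕ => ∫⁻ x, ‖U p.1 (q, x) - U p.2 (q, x)‖ₑ ∂cauchyWeight)
      (atTop ×ˢ atTop) (𝓝 0) := by
  set f : ℕ × ℕ → ℝ → ℝ := fun p x => U p.1 (q, x) - U p.2 (q, x) with hf
  have hfm : ∀ p, Measurable (f p) := fun p =>
    (h.measurable_slice p.1 q).sub (h.measurable_slice p.2 q)
  have hfb : ∀ p x, |f p x| ≤ 2 * B := fun p x => h.abs_sub_le p _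
  have hfV : ∀ p y, ∫⁻ x, ‖f p (x + y) - f p x‖ₑ ≤ ENNReal.ofReal (2 * V * |y|) := by
    intro p y
    have hV := h.nonneg_V
    calc _ ≤ ∫⁻ x, (‖U p.1 (q, x + y) - U p.1 (q, x)‖ₑ + ‖U p.2 (q, x + y) - U p.2 (q, x)‖ₑ) := by
          refine lintegral_mono fun x => ?_
          simp only [hf]
          rw [sub_sub_sub_comm]
          exact _root_.enorm_sub_le
      _ = _ := by
          refine lintegral_add_left ?_ _
          exact (((h.measurable_slice p.1 q).comp (measurable_id.add_const y)).sub
            (h.measurable_slice p.1 q)).enorm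
      _ ≤ _ := add_le_add (h.space_le p.1 q y) (h.space_le p.2 q y)
      _ = _ := by
          rw [← ENNReal.ofReal_add (by positivity) (by positivity)]
          congr 1; ring
  have hav : ∀ δ > 0, Tendsto (fun p => ∫⁻ x, ‖fwdAverage (f p) δ x‖ₑ ∂cauchyWeight)
      (atTop ×ˢ atTop) (𝓝 0) := by
    intro δ hδ
    have := tendsto_lintegral_filter_of_dominated_convergence (μ := cauchyWeight)
      (l := (atTop ×ˢ atTop : Filter (ℕ × ℕ))) (F := fun p x => ‖fwdAverage (f p) δ x‖ₑ)
      (f := fun _ => 0) (fun _ => ENNReal.ofReal (2 * B)) ?_ ?_ ?_ ?_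
    · simpa using this
    · exact Eventually.of_forall fun p =>
        (continuous_fwdAverage (hfm p) (hfb p) δ).measurable.enorm
    · refine Eventually.of_forall fun p => Eventually.of_forall fun x => ?_
      rw [Real.enorm_eq_ofReal_abs]
      exact ENNReal.ofReal_le_ofReal (abs_fwdAverage_le (hfb p) hδ x)
    · rw [lintegral_const]
      exact ENNReal.mul_ne_top ENNReal.ofReal_ne_top (measure_ne_top _ _)
    · refine Eventually.of_forall fun x => ?_
      have e : ∀ p, fwdAverage (f p) δ x =
          δ⁻¹ * ((∫ y in (0 : ℝ)..x + δ, f p y) - ∫ y in (0 : ℝ)..x, f p y) := fun p => by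
        have hi := intervalIntegrable_of_abs_le (hfm p) (hfb p)
        rw [fwdAverage, intervalIntegral.integral_interval_sub_left (hi _ _) (hi _ _)]
      simp only [e]
      have := (((h.tendsto_integral_sub hl q (x + δ)).sub
        (h.tendsto_integral_sub hl q x)).const_mul δ⁻¹).enorm
      simpa using this
  have hle : ∀ δ > 0, ∀ p, ∫⁻ x, ‖f p x‖ₑ ∂cauchyWeight ≤
      (∫⁻ x, ‖fwdAverage (f p) δ x‖ₑ ∂cauchyWeight) + ENNReal.ofReal (2 * V * δ) := by
    intro δ hδ p
    have hV := h.nonneg_V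
    have hcm : Measurable (fwdAverage (f p) δ) := (continuous_fwdAverage (hfm p) (hfb p) δ).measurable
    calc _ ≤ ∫⁻ x, (‖fwdAverage (f p) δ x‖ₑ + ‖fwdAverage (f p) δ x - f p x‖ₑ) ∂cauchyWeight := by
          refine lintegral_mono fun x => ?_
          calc ‖f p x‖ₑ = ‖fwdAverage (f p) δ x - (fwdAverage (f p) δ x - f p x)‖ₑ := by
                rw [sub_sub_cancel]
            _ ≤ _ := _root_.enorm_sub_le
      _ = (∫⁻ x, ‖fwdAverage (f p) δ x‖ₑ ∂cauchyWeight) +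
            ∫⁻ x, ‖fwdAverage (f p) δ x - f p x‖ₑ ∂cauchyWeight := lintegral_add_left hcm.enorm _
      _ ≤ _ := by
          gcongr
          exact (lintegral_mono' cauchyWeight_le le_rfl).trans
            (lintegral_sub_fwdAverage_le (hfm p) (hfb p) hδ (by positivity) (hfV p))
  rw [ENNReal.tendsto_nhds_zero]
  intro η hη
  obtain ⟨δ, hδ, hδη⟩ : ∃ δ > 0, ENNReal.ofReal (2 * V * δ) < η := by
    have h1 : Tendsto (fun δ : ℝ => ENNReal.ofReal (2 * V * δ)) (𝓝[>] 0) (𝓝 0) := by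
      have : Continuous fun δ : ℝ => ENNReal.ofReal (2 * V * δ) :=
        ENNReal.continuous_ofReal.comp (by fun_prop)
      simpa using (this.tendsto 0).mono_left nhdsWithin_le_nhds
    exact ((eventually_mem_nhdsWithin).and (h1.eventually_lt_const hη)).exists
  have h2 := (hav δ hδ).add_const (ENNReal.ofReal (2 * V * δ))
  rw [zero_add] at h2
  filter_upwards [h2.eventually_lt_const hδη] with p hp
  exact (hle δ hδ p).trans hp.le

/-- The time estimate carries convergence from rational times to all `t ≥ 0`; the errors `ε` vanish
along the sequence. -/
theorem tendsto_lintegral_sub {t : ℝ} (ht : 0 ≤ t) :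
    Tendsto (fun p : ℕ × ℕ => ∫⁻ x, ‖U p.1 (t, x) - U p.2 (t, x)‖ₑ ∂cauchyWeight)
      (atTop ×ˢ atTop) (𝓝 0) := by
  have he : Tendsto (fun p : ℕ × ℕ => ε p.1 + ε p.2) (atTop ×ˢ atTop) (𝓝 0) := by
    simpa using (h.tendsto_eps.comp tendsto_fst).add (h.tendsto_eps.comp tendsto_snd)
  refine tendsto_zero_of_tendsto_rat (S := Ici 0)
    (d := fun (p : ℕ × ℕ) t => ∫⁻ x, ‖U p.1 (t, x) - U p.2 (t, x)‖ₑ ∂cauchyWeight)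
    (L := 2 * C) (isUpperSet_Ici 0) he ?_ (fun q _ => h.tendsto_lintegral_sub_rat hl) ht
  intro p s hs t ht
  have hC := h.nonneg_C
  have hm := h.measurable_slice
  calc _ ≤ ∫⁻ x, (‖U p.1 (s, x) - U p.2 (s, x)‖ₑ + (‖U p.1 (t, x) - U p.1 (s, x)‖ₑ +
          ‖U p.2 (t, x) - U p.2 (s, x)‖ₑ)) ∂cauchyWeight := by
        refine lintegral_mono fun x => ?_
        have e : U p.1 (t, x) - U p.2 (t, x) = (U p.1 (s, x) - U p.2 (s, x)) +
            ((U p.1 (t, x) - U p.1 (s, x)) - (U p.2 (t, x) - U p.2 (s, x))) := by ring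
        simp only [e]
        exact (enorm_add_le _ _).trans (by gcongr; exact _root_.enorm_sub_le)
    _ = (∫⁻ x, ‖U p.1 (s, x) - U p.2 (s, x)‖ₑ ∂cauchyWeight) +
          ((∫⁻ x, ‖U p.1 (t, x) - U p.1 (s, x)‖ₑ ∂cauchyWeight) +
            ∫⁻ x, ‖U p.2 (t, x) - U p.2 (s, x)‖ₑ ∂cauchyWeight) := by
        have hme : ∀ (k l : ℕ) (t s : ℝ), Measurable fun x => ‖U k (t, x) - U l (s, x)‖ₑ :=
          fun k l t s => ((hm k t).sub (hm l s)).enorm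
        rw [lintegral_add_left (hme _ _ _ _), lintegral_add_left (hme _ _ _ _)]
    _ ≤ (∫⁻ x, ‖U p.1 (s, x) - U p.2 (s, x)‖ₑ ∂cauchyWeight) +
          (ENNReal.ofReal (C * (|t - s| + ε p.1)) + ENNReal.ofReal (C * (|t - s| + ε p.2))) := by
        gcongr
        · exact (lintegral_mono' cauchyWeight_le le_rfl).trans (h.time_le p.1 s hs t ht)
        · exact (lintegral_mono' cauchyWeight_le le_rfl).trans (h.time_le p.2 s hs t ht)
    _ ≤ _ := by
        have h1 := h.nonneg_eps p.1
        have h2 := h.nonneg_eps p.2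
        rw [← ENNReal.ofReal_add (by positivity) (by positivity)]
        gcongr
        nlinarith

theorem tendsto_lintegral_prod_sub :
    Tendsto (fun p : ℕ × ℕ => ∫⁻ z, ‖U p.1 z - U p.2 z‖ₑ ∂halfPlaneWeight)
      (atTop ×ˢ atTop) (𝓝 0) := by
  have hm : ∀ p : ℕ × ℕ, Measurable fun z => ‖U p.1 z - U p.2 z‖ₑ := fun p =>
    ((h.measurable p.1).sub (h.measurable p.2)).enorm
  have e : ∀ p : ℕ × ℕ, ∫⁻ z, ‖U p.1 z - U p.2 z‖ₑ ∂halfPlaneWeight =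
      ∫⁻ t in Ici 0, ∫⁻ x, ‖U p.1 (t, x) - U p.2 (t, x)‖ₑ ∂cauchyWeight ∂cauchyWeight :=
    fun p => lintegral_prod _ (hm p).aemeasurable
  simp only [e]
  have := tendsto_lintegral_filter_of_dominated_convergence (μ := cauchyWeight.restrict (Ici 0))
    (l := (atTop ×ˢ atTop : Filter (ℕ × ℕ)))
    (F := fun p t => ∫⁻ x, ‖U p.1 (t, x) - U p.2 (t, x)‖ₑ ∂cauchyWeight)
    (f := fun _ => 0) (fun _ => ENNReal.ofReal (2 * B) * cauchyWeight univ) ?_ ?_ ?_ ?_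
  · simpa using this
  · exact Eventually.of_forall fun p => (hm p).lintegral_prod_right'
  · refine Eventually.of_forall fun p => Eventually.of_forall fun t => ?_
    rw [← lintegral_const]
    exact lintegral_mono fun x => h.enorm_sub_le p _
  · rw [lintegral_const]
    exact ENNReal.mul_ne_top (ENNReal.mul_ne_top ENNReal.ofReal_ne_top (measure_ne_top _ _))
      (measure_ne_top _ _)
  · filter_upwards [ae_restrict_mem measurableSet_Ici] with t ht
    exact h.tendsto_lintegral_sub hl ht

theorem exists_tendsto_halfPlaneWeight :
    ∃ u : ℝ × ℝ → ℝ, MemLp u 1 halfPlaneWeight ∧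
      Tendsto (fun k => eLpNorm (U k - u) 1 halfPlaneWeight) atTop (𝓝 0) := by
  have hmem : ∀ k, MemLp (U k) 1 halfPlaneWeight := fun k =>
    MemLp.of_bound (h.measurable k).aestronglyMeasurable B (Eventually.of_forall (h.abs_le k))
  have hc : CauchySeq fun k => (hmem k).toLp (U k) := by
    rw [EMetric.cauchySeq_iff]
    intro η hη
    have h1 := (h.tendsto_lintegral_prod_sub hl).eventually_lt_const hη
    rw [prod_atTop_atTop_eq, eventually_atTop_prod_self'] at h1
    obtain ⟨N, hN⟩ := h1
    refine ⟨N, fun m hm n hn => ?_⟩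
    rw [Lp.edist_toLp_toLp, eLpNorm_one_eq_lintegral_enorm]
    exact hN m hm n hn
  obtain ⟨u, hu⟩ := cauchySeq_tendsto_of_complete hc
  refine ⟨u, Lp.memLp u, ?_⟩
  rwa [← Lp.tendsto_Lp_iff_tendsto_eLpNorm'' U hmem u (Lp.memLp u), Lp.toLp_coeFn]

omit hl in
theorem exists_subseq_tendsto_halfPlaneWeight :
    ∃ σ : ℕ → ℕ, StrictMono σ ∧ ∃ u : ℝ × ℝ → ℝ, MemLp u 1 halfPlaneWeight ∧
      Tendsto (fun k => eLpNorm (U (σ k) - u) 1 halfPlaneWeight) atTop (𝓝 0) := by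
  obtain ⟨σ, hσ, hl⟩ := h.exists_subseq_tendsto_integral
  exact ⟨σ, hσ, (h.comp hσ).exists_tendsto_halfPlaneWeight hl⟩

end UniformBV

/-! ### Bounded variation of the limit -/

theorem memLp_one_restrict_of_halfPlaneWeight {u : ℝ × ℝ → ℝ} (hu : MemLp u 1 halfPlaneWeight)
    {K : Set (ℝ × ℝ)} (hK : Bornology.IsBounded K) (hK0 : K ⊆ Ici 0 ×ˢ univ) :
    MemLp u 1 (volume.restrict K) := by
  obtain ⟨c, hc, hle⟩ := exists_restrict_le_halfPlaneWeight hK hK0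
  exact (hu.smul_measure hc).mono_measure hle

theorem tendsto_eLpNorm_restrict_of_halfPlaneWeight {U : ℕ → ℝ × ℝ → ℝ} {u : ℝ × ℝ → ℝ}
    (h : Tendsto (fun k => eLpNorm (U k - u) 1 halfPlaneWeight) atTop (𝓝 0))
    {K : Set (ℝ × ℝ)} (hK : Bornology.IsBounded K) (hK0 : K ⊆ Ici 0 ×ˢ univ) :
    Tendsto (fun k => eLpNorm (U k - u) 1 (volume.restrict K)) atTop (𝓝 0) := by
  obtain ⟨c, hc, hle⟩ := exists_restrict_le_halfPlaneWeight hK hK0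
  have h1 : Tendsto (fun k => c * eLpNorm (U k - u) 1 halfPlaneWeight) atTop (𝓝 (c * 0)) :=
    ENNReal.Tendsto.const_mul h (Or.inr hc)
  rw [mul_zero] at h1
  refine tendsto_of_tendsto_of_tendsto_of_le_of_le tendsto_const_nhds h1 (fun _ => zero_le) ?_
  intro k
  refine (eLpNorm_mono_measure _ hle).trans (le_of_eq ?_)
  rw [eLpNorm_one_smul_measure]

theorem tendsto_setIntegral_mul_of_L1 {U : ℕ → ℝ × ℝ → ℝ} {u ψ : ℝ × ℝ → ℝ}
    {μ : Measure (ℝ × ℝ)} {c : ℝ} (hU : ∀ k, MemLp (U k) 1 μ) (hu : MemLp u 1 μ)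
    (h : Tendsto (fun k => eLpNorm (U k - u) 1 μ) atTop (𝓝 0))
    (hψ : Measurable ψ) (hc : ∀ z, |ψ z| ≤ c) :
    Tendsto (fun k => ∫ z, U k z * ψ z ∂μ) atTop (𝓝 (∫ z, u z * ψ z ∂μ)) := by
  have hψb : ∀ᵐ z ∂μ, ‖ψ z‖ ≤ c := Eventually.of_forall hc
  have hi : ∀ {f : ℝ × ℝ → ℝ}, MemLp f 1 μ → Integrable (fun z => f z * ψ z) μ := fun hf =>
    (memLp_one_iff_integrable.1 hf).mul_bdd hψ.aestronglyMeasurable hψb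
  refine tendsto_integral_of_L1' _ (hi hu).aestronglyMeasurable
    (Eventually.of_forall fun k => hi (hU k)) ?_
  have h1 : Tendsto (fun k => ENNReal.ofReal c * eLpNorm (U k - u) 1 μ) atTop
      (𝓝 (ENNReal.ofReal c * 0)) :=
    ENNReal.Tendsto.const_mul h (Or.inr ENNReal.ofReal_ne_top)
  rw [mul_zero] at h1
  refine tendsto_of_tendsto_of_tendsto_of_le_of_le tendsto_const_nhds h1 (fun _ => zero_le) ?_
  intro k
  refine eLpNorm_le_mul_eLpNorm_of_ae_le_mul (Eventually.of_forall fun z => ?_) 1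
  simp only [Pi.sub_apply, ← sub_mul, norm_mul]
  rw [mul_comm]
  gcongr
  exact hc z

theorem setIntegral_mul_translate {f φ : ℝ × ℝ → ℝ} {Ω : Set (ℝ × ℝ)} {η : ℝ}
    (hη : Metric.cthickening η (tsupport φ) ⊆ Ω) {v : ℝ × ℝ} (hv : ‖v‖ ≤ η) :
    ∫ z in Ω, f z * φ (z + v) = ∫ z, f (z - v) * φ z := by
  rw [setIntegral_eq_integral_of_forall_compl_eq_zero]
  · rw [← integral_sub_right_eq_self _ v]
    simp
  · intro z hz
    have : φ (z + v) = 0 := by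
      by_contra hne
      refine hz (hη (Metric.mem_cthickening_of_dist_le z (z + v) η _ (subset_tsupport _ hne) ?_))
      simpa [dist_eq_norm] using hv
    rw [this, mul_zero]

namespace UniformBV

variable {U : ℕ → ℝ × ℝ → ℝ} {ε : ℕ → ℝ} {B V C : ℝ} (h : UniformBV U ε B V C)
include h

theorem lintegral_translate_le (k : ℕ) {t : ℝ} (ht : 0 ≤ t) {v : ℝ × ℝ} (hv : 0 ≤ t - v.1) :
    ∫⁻ x, ‖U k ((t, x) - v) - U k (t, x)‖ₑ ≤
      ENNReal.ofReal (V * |v.2| + C * (|v.1| + ε k)) := by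
  have hm := h.measurable_slice k
  have hV := h.nonneg_V
  have hC := h.nonneg_C
  have hε := h.nonneg_eps k
  have h1 := h.space_le k (t - v.1) (-v.2)
  have h2 := h.time_le k t ht (t - v.1) hv
  rw [abs_neg] at h1
  rw [sub_sub_cancel_left, abs_neg] at h2
  have hm1 : Measurable fun x => ‖U k (t - v.1, x + -v.2) - U k (t - v.1, x)‖ₑ :=
    (((hm _).comp (measurable_id.add_const _)).sub (hm _)).enorm
  calc _ ≤ ∫⁻ x, (‖U k (t - v.1, x + -v.2) - U k (t - v.1, x)‖ₑ +
          ‖U k (t - v.1, x) - U k (t, x)‖ₑ) := by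
        refine lintegral_mono fun x => ?_
        refine le_trans (le_of_eq ?_) (enorm_add_le _ _)
        rw [sub_add_sub_cancel, ← sub_eq_add_neg]
        rfl
    _ = _ := lintegral_add_left hm1 _
    _ ≤ _ := add_le_add h1 h2
    _ = _ := (ENNReal.ofReal_add (by positivity) (by positivity)).symm

theorem setIntegral_mul_translate_sub_le (k : ℕ) {T A η : ℝ} (hT : 0 ≤ T) {φ : ℝ × ℝ → ℝ}
    (hφ : Continuous φ) (hφc : HasCompactSupport φ) (hφ1 : ∀ z, |φ z| ≤ 1)
    (hη : Metric.cthickening η (tsupport φ) ⊆ Ioo (0 : ℝ) T ×ˢ Ioo (-A) A) {v : ℝ × ℝ}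
    (hv : ‖v‖ ≤ η) :
    ∫ z in Ioo (0 : ℝ) T ×ˢ Ioo (-A) A, U k z * (φ (z + v) - φ z) ≤
      T * (V * |v.2| + C * (|v.1| + ε k)) := by
  set Ω := Ioo (0 : ℝ) T ×ˢ Ioo (-A) A with hΩ
  set c := V * |v.2| + C * (|v.1| + ε k) with hc
  have hc0 : 0 ≤ c := by
    have hV := h.nonneg_V
    have hC := h.nonneg_C
    have hε := h.nonneg_eps k
    positivity
  have hφi : Integrable φ := hφ.integrable_of_hasCompactSupport hφc
  have hb : ∀ᵐ z, ‖U k z‖ ≤ B := Eventually.of_forall (h.abs_le k)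
  have hb' : ∀ᵐ z, ‖U k (z - v)‖ ≤ B := Eventually.of_forall fun z => h.abs_le k _
  have i1 : Integrable fun z => U k z * φ z := hφi.bdd_mul (h.measurable k).aestronglyMeasurable hb
  have i2 : Integrable fun z => U k z * φ (z + v) :=
    (hφi.comp_add_right v).bdd_mul (h.measurable k).aestronglyMeasurable hb
  have i3 : Integrable fun z => U k (z - v) * φ z :=
    hφi.bdd_mul ((h.measurable k).comp (measurable_id.sub_const v)).aestronglyMeasurable hb'
  have e : ∫ z in Ω, U k z * (φ (z + v) - φ z) = ∫ z, (U k (z - v) - U k z) * φ z := by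
    simp_rw [mul_sub, sub_mul]
    have e0 := setIntegral_mul_translate (f := U k) hη (v := 0) (by
      simpa using (norm_nonneg v).trans hv)
    simp only [add_zero, sub_zero] at e0
    rw [integral_sub i2.integrableOn i1.integrableOn, integral_sub i3 i1,
      setIntegral_mul_translate hη hv, e0]
  have key : ∫⁻ z, ‖(U k (z - v) - U k z) * φ z‖ₑ ≤ ENNReal.ofReal (T * c) := by
    calc _ ≤ ∫⁻ t, ∫⁻ x, ‖(U k ((t, x) - v) - U k (t, x)) * φ (t, x)‖ₑ := by
          rw [Measure.volume_eq_prod]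
          exact lintegral_prod_le _
      _ ≤ ∫⁻ t, (Ioo 0 T).indicator (fun _ => ENNReal.ofReal c) t := by
          refine lintegral_mono fun t => ?_
          -- The time estimate needs `t` and `t - v.1` nonnegative. Only slices meeting the support
          -- of `φ` contribute, and there the thickening condition keeps both times in `(0, T)`.
          by_cases hex : ∃ x, φ (t, x) ≠ 0
          · obtain ⟨x, hx⟩ := hex
            have hx' : (t, x) ∈ tsupport φ := subset_tsupport _ hx
            have m1 : (t, x) ∈ Ω := hη (Metric.self_subset_cthickening _ hx')
            have m2 : (t, x) - v ∈ Ω := hη (Metric.mem_cthickening_of_dist_le _ (t, x) η _ hx' (by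
              simpa [dist_eq_norm] using hv))
            have ht : 0 ≤ t - v.1 := m2.1.1.le
            rw [indicator_of_mem m1.1]
            refine le_trans (lintegral_mono fun x => ?_) (h.lintegral_translate_le k m1.1.1.le ht)
            rw [enorm_mul]
            refine mul_le_of_le_one_right zero_le ?_
            rw [Real.enorm_eq_ofReal_abs, ENNReal.ofReal_le_one]
            exact hφ1 _
          · push Not at hex
            simp [hex]
      _ = _ := by
          rw [lintegral_indicator_const measurableSet_Ioo, Real.volume_Ioo, sub_zero,
            ← ENNReal.ofReal_mul hc0, mul_comm]
  rw [e]
  have h1 := (enorm_integral_le_lintegral_enorm _).trans key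
  rw [Real.enorm_eq_ofReal_abs, ENNReal.ofReal_le_ofReal_iff (by positivity)] at h1
  exact (le_abs_self _).trans h1

variable {u : ℝ × ℝ → ℝ} (hu : MemLp u 1 halfPlaneWeight)
  (hlim : Tendsto (fun k => eLpNorm (U k - u) 1 halfPlaneWeight) atTop (𝓝 0))
include hu hlim

/-- The limit in `k` is taken at fixed `v`. It removes `ε k`, which would not survive the later
division by the length of the translation. -/
theorem limit_setIntegral_mul_translate_sub_le {T A η : ℝ} (hT : 0 ≤ T) {φ : ℝ × ℝ → ℝ}
    (hφ : Continuous φ) (hφc : HasCompactSupport φ) (hφ1 : ∀ z, |φ z| ≤ 1)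
    (hη : Metric.cthickening η (tsupport φ) ⊆ Ioo (0 : ℝ) T ×ˢ Ioo (-A) A) {v : ℝ × ℝ}
    (hv : ‖v‖ ≤ η) :
    ∫ z in Ioo (0 : ℝ) T ×ˢ Ioo (-A) A, u z * (φ (z + v) - φ z) ≤
      T * (V * |v.2| + C * |v.1|) := by
  have hbd : Bornology.IsBounded (Ioo (0 : ℝ) T ×ˢ Ioo (-A) A) :=
    (Metric.isBounded_Ioo _ _).prod (Metric.isBounded_Ioo _ _)
  have hsub : Ioo (0 : ℝ) T ×ˢ Ioo (-A) A ⊆ Ici 0 ×ˢ univ := fun z hz => ⟨hz.1.1.le, trivial⟩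
  have hmem : ∀ k, MemLp (U k) 1 halfPlaneWeight := fun k =>
    MemLp.of_bound (h.measurable k).aestronglyMeasurable B (Eventually.of_forall (h.abs_le k))
  have h1 := tendsto_setIntegral_mul_of_L1 (ψ := fun z => φ (z + v) - φ z) (c := 2)
    (fun k => memLp_one_restrict_of_halfPlaneWeight (hmem k) hbd hsub)
    (memLp_one_restrict_of_halfPlaneWeight hu hbd hsub)
    (tendsto_eLpNorm_restrict_of_halfPlaneWeight hlim hbd hsub)
    (by fun_prop : Continuous fun z => φ (z + v) - φ z).measurable
    (fun z => (abs_sub _ _).trans (by linarith [hφ1 z, hφ1 (z + v)]))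
  have h2 : Tendsto (fun k => T * (V * |v.2| + C * (|v.1| + ε k))) atTop
      (𝓝 (T * (V * |v.2| + C * (|v.1| + 0)))) :=
    (((h.tendsto_eps.const_add _).const_mul C).const_add _).const_mul T
  rw [add_zero] at h2
  exact le_of_tendsto_of_tendsto' h1 h2 fun k =>
    h.setIntegral_mul_translate_sub_le k hT hφ hφc hφ1 hη hv

theorem memBVLoc : MemBVLoc u := by
  intro T hT A hA
  have hbd : Bornology.IsBounded (Ioo (0 : ℝ) T ×ˢ Ioo (-A) A) :=
    (Metric.isBounded_Ioo _ _).prod (Metric.isBounded_Ioo _ _)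
  have hsub : Ioo (0 : ℝ) T ×ˢ Ioo (-A) A ⊆ Ici 0 ×ˢ univ := fun z hz => ⟨hz.1.1.le, trivial⟩
  have hint : IntegrableOn u (Ioo (0 : ℝ) T ×ˢ Ioo (-A) A) :=
    memLp_one_iff_integrable.1 (memLp_one_restrict_of_halfPlaneWeight hu hbd hsub)
  refine ⟨hint, fun e => ⟨T * (V * |e.2| + C * |e.1|), fun φ hφ hφc hφΩ hφ1 => ?_⟩⟩
  obtain ⟨η, hη0, hη⟩ := IsCompact.exists_cthickening_subset_open hφc
    (isOpen_Ioo.prod isOpen_Ioo) hφΩ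
  -- The Lipschitz constant of `φ` dominates its difference quotients, so they may be replaced by
  -- the directional derivative under the integral.
  obtain ⟨L, hL⟩ := hφ.lipschitzWith_of_hasCompactSupport hφc one_ne_zero
  set δ : ℕ → ℝ := fun n => 1 / ((n : ℝ) + 1) with hδ
  have hδp : ∀ n, 0 < δ n := fun n => by positivity
  have hδ0 : Tendsto δ atTop (𝓝 0) := tendsto_one_div_add_atTop_nhds_zero_nat
  have hlim1 : Tendsto (fun n => ∫ z in Ioo (0 : ℝ) T ×ˢ Ioo (-A) A,
      u z * ((δ n)⁻¹ • (φ (z + δ n • e) - φ z))) atTop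
      (𝓝 (∫ z in Ioo (0 : ℝ) T ×ˢ Ioo (-A) A, u z * fderiv ℝ φ z e)) := by
    refine tendsto_integral_of_dominated_convergence (fun z => |u z| * (L * ‖e‖)) ?_ ?_ ?_ ?_
    · intro n
      have := hφ.continuous
      exact hint.aestronglyMeasurable.mul (by fun_prop : Continuous fun z =>
        (δ n)⁻¹ • (φ (z + δ n • e) - φ z)).aestronglyMeasurable
    · exact hint.abs.mul_const _
    · intro n
      refine Eventually.of_forall fun z => ?_
      rw [norm_mul, Real.norm_eq_abs, norm_smul, norm_inv, Real.norm_of_nonneg (hδp n).le]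
      refine mul_le_mul_of_nonneg_left ?_ (abs_nonneg _)
      rw [inv_mul_le_iff₀ (hδp n)]
      refine (hL.norm_sub_le _ _).trans (le_of_eq ?_)
      rw [add_sub_cancel_left, norm_smul, Real.norm_of_nonneg (hδp n).le]
      ring
    · refine Eventually.of_forall fun z => ?_
      have hd : HasLineDerivAt ℝ φ (fderiv ℝ φ z e) z e :=
        ((hφ.differentiable one_ne_zero) z).hasFDerivAt.hasLineDerivAt e
      exact (hd.tendsto_slope_zero_right.comp
        (tendsto_nhdsWithin_iff.2 ⟨hδ0, Eventually.of_forall hδp⟩)).const_mul _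
  refine le_of_tendsto hlim1 ?_
  have hsmall : ∀ᶠ n in atTop, ‖δ n • e‖ < η := by
    have : Tendsto (fun n => ‖δ n • e‖) atTop (𝓝 ‖(0 : ℝ) • e‖) := (hδ0.smul_const e).norm
    rw [zero_smul, norm_zero] at this
    exact this.eventually_lt_const hη0
  filter_upwards [hsmall] with n hn
  have := h.limit_setIntegral_mul_translate_sub_le hu hlim hT.le hφ.continuous hφc hφ1 hη hn.le
  simp only [Prod.smul_snd, Prod.smul_fst, smul_eq_mul, abs_mul, abs_of_pos (hδp n)] at this
  have e1 : ∫ z in Ioo (0 : ℝ) T ×ˢ Ioo (-A) A,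
      u z * ((δ n)⁻¹ • (φ (z + δ n • e) - φ z)) = (δ n)⁻¹ *
      ∫ z in Ioo (0 : ℝ) T ×ˢ Ioo (-A) A, u z * (φ (z + δ n • e) - φ z) := by
    rw [← integral_const_mul]
    congr 1; funext z; rw [smul_eq_mul]; ring
  rw [e1, inv_mul_le_iff₀ (hδp n)]
  linarith

omit h hu in
theorem tendstoL1Loc : TendstoL1Loc U u := fun _ hK hK0 =>
  tendsto_eLpNorm_restrict_of_halfPlaneWeight hlim hK.isBounded hK0

end UniformBV

/-! ### Convergence of the particle trajectories -/

theorem hasWeakDeriv_of_eq_integral {f g : ℝ → ℝ} {c b T : ℝ} (hT : 0 < T) (hg : Measurable g)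
    (hb : ∀ x, |g x| ≤ b) (hf : ∀ x ∈ Ioo 0 T, f x = c + ∫ y in (0 : ℝ)..x, g y) :
    HasWeakDeriv (Ioo 0 T) f g := by
  have hi := intervalIntegrable_of_abs_le hg hb
  have hgl := locallyIntegrable_of_abs_le hg hb
  set F : ℝ → ℝ := fun x => c + ∫ y in (0 : ℝ)..x, g y with hF
  have hFc : Continuous F :=
    continuous_const.add (intervalIntegral.continuous_primitive hi 0)
  have hFi : IntegrableOn F (Ioo 0 T) :=
    (hFc.integrableOn_Icc (a := 0) (b := T)).mono_set Ioo_subset_Icc_self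
  refine ⟨((integrableOn_congr_fun hf measurableSet_Ioo).2 hFi).locallyIntegrableOn,
    hgl.locallyIntegrableOn _, fun φ hφ hφc hφs => ?_⟩
  have hout : ∀ x, x ∉ Ioo 0 T → φ x = 0 := fun x hx =>
    image_eq_zero_of_notMem_tsupport fun h => hx (hφs h)
  -- The integrand `g` may jump, so integration by parts is done for absolutely continuous
  -- functions, with `F' = g` almost everywhere.
  have hFac : AbsolutelyContinuousOnInterval F 0 T := by
    have hlip : LipschitzWith (Real.toNNReal b) F := by
      refine LipschitzWith.of_dist_le_mul fun x y => ?_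
      have hb0 : 0 ≤ b := (abs_nonneg _).trans (hb 0)
      rw [Real.dist_eq, Real.dist_eq, Real.coe_toNNReal b hb0, hF]
      simp only
      rw [add_sub_add_left_eq_sub, intervalIntegral.integral_interval_sub_left (hi _ _) (hi _ _)]
      exact abs_integral_le_of_abs_le hb y x
    exact (hlip.lipschitzOnWith (s := uIcc 0 T)).absolutelyContinuousOnInterval
  have hφac : AbsolutelyContinuousOnInterval φ 0 T :=
    ((hφ.of_le (by simp) : ContDiff ℝ 1 φ).contDiffOn).absolutelyContinuousOnInterval
  have hparts := hFac.integral_mul_deriv_eq_deriv_mul hφac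
  rw [hout 0 (by simp), hout T (by simp), mul_zero, mul_zero, sub_self, zero_sub,
    intervalIntegral.integral_of_le hT.le, intervalIntegral.integral_of_le hT.le,
    integral_Ioc_eq_integral_Ioo, integral_Ioc_eq_integral_Ioo] at hparts
  rw [setIntegral_congr_fun (g := fun x => F x * deriv φ x) measurableSet_Ioo
    (fun x hx => by simp only [hf x hx, hF]), hparts]
  congr 1
  apply integral_congr_ae
  apply ae_restrict_of_ae
  filter_upwards [_root_.LocallyIntegrable.ae_hasDerivAt_integral hgl] with x hx
  rw [((hx 0).const_add c).deriv]

theorem memLp_top_Ioo_of_abs_le {f : ℝ → ℝ} {b T : ℝ} (hf : Measurable f)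
    (hb : ∀ x ∈ Ioo 0 T, |f x| ≤ b) : MemLp f ⊤ (volume.restrict (Ioo 0 T)) :=
  memLp_top_of_bound hf.aestronglyMeasurable b
    ((ae_restrict_mem measurableSet_Ioo).mono hb)

theorem memWInfLoc_two_of_lipschitz {v : ℝ → ℝ} {K : NNReal} {b c : ℝ} (hv : LipschitzWith K v)
    (hb : ∀ x, |v x| ≤ b) : MemWInfLoc 2 fun t => c + ∫ s in (0 : ℝ)..t, v s := by
  intro T hT
  have hvc := hv.continuous
  have hi := fun x y => hvc.intervalIntegrable (μ := volume) x y
  have hb0 : 0 ≤ b := (abs_nonneg _).trans (hb 0)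
  have hdb : ∀ x, |deriv v x| ≤ K := fun x => by
    simpa using norm_deriv_le_of_lipschitz (x₀ := x) hv
  refine ⟨?_, v, hasWeakDeriv_of_eq_integral hT hvc.measurable hb fun x _ => rfl, ?_, deriv v,
    hasWeakDeriv_of_eq_integral (c := v 0) hT (measurable_deriv v) hdb fun x _ => ?_, ?_⟩
  · refine memLp_top_Ioo_of_abs_le (b := |c| + b * T) ?_ fun x hx => ?_
    · exact (continuous_const.add (intervalIntegral.continuous_primitive hi 0)).measurable
    · refine (abs_add_le _ _).trans ?_
      gcongr
      refine (abs_integral_le_of_abs_le hb 0 x).trans ?_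
      rw [sub_zero, abs_of_pos hx.1]
      exact mul_le_mul_of_nonneg_left hx.2.le hb0
  · exact memLp_top_Ioo_of_abs_le hvc.measurable fun x _ => hb x
  · rw [((hv.lipschitzOnWith (s := uIcc 0 x)).absolutelyContinuousOnInterval).integral_deriv_eq_sub]
    ring
  · exact memLp_top_Ioo_of_abs_le (measurable_deriv v) fun x _ => hdb x

theorem tendstoW1InfLoc_of_uniform {w : ℕ → ℝ → ℝ} {v : ℝ → ℝ} {H : ℕ → ℝ → ℝ} {b c : ℝ}
    (hw : ∀ k, Measurable (w k)) (hwb : ∀ k x, |w k x| ≤ b)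
    (hv : Measurable v) (hvb : ∀ x, |v x| ≤ b)
    (hH : ∀ k, ∀ t ≥ 0, H k t = c + ∫ s in (0 : ℝ)..t, w k s)
    (hlim : ∀ T > 0, ∀ η > 0, ∀ᶠ k in atTop, ∀ t ∈ Icc 0 T, |w k t - v t| ≤ η) :
    TendstoW1InfLoc H fun t => c + ∫ s in (0 : ℝ)..t, v s := by
  intro T hT
  have key : ∀ η > 0, ∀ᶠ k in atTop,
      normW1Inf (Ioo 0 T) (H k - fun t => c + ∫ s in (0 : ℝ)..t, v s) ≤
        ENNReal.ofReal (η * T) + ENNReal.ofReal η := by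
    intro η hη
    filter_upwards [hlim T hT η hη] with k hk
    have hd : ∀ t ∈ Ioo 0 T, (H k - fun t => c + ∫ s in (0 : ℝ)..t, v s) t =
        0 + ∫ s in (0 : ℝ)..t, (w k s - v s) := by
      intro t ht
      rw [Pi.sub_apply, hH k t ht.1.le, add_sub_add_left_eq_sub, zero_add,
        intervalIntegral.integral_sub (intervalIntegrable_of_abs_le (hw k) (hwb k) _ _)
          (intervalIntegrable_of_abs_le hv hvb _ _)]
    have hwd : HasWeakDeriv (Ioo 0 T) (H k - fun t => c + ∫ s in (0 : ℝ)..t, v s)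
        (fun s => w k s - v s) :=
      hasWeakDeriv_of_eq_integral (b := b + b) hT ((hw k).sub hv) (fun x =>
        (abs_sub _ _).trans (add_le_add (hwb k x) (hvb x))) hd
    -- The norm is an infimum over weak derivatives, so exhibiting one suffices for an upper bound.
    refine (iInf₂_le _ hwd).trans ?_
    rw [eLpNorm_exponent_top, eLpNorm_exponent_top]
    refine add_le_add ?_ ?_
    · refine eLpNormEssSup_le_of_ae_bound ?_
      filter_upwards [ae_restrict_mem measurableSet_Ioo] with t ht
      rw [hd t ht, zero_add]
      have hle : ∀ s ∈ uIoc 0 t, ‖w k s - v s‖ ≤ η := fun s hs => by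
        rw [uIoc_of_le ht.1.le] at hs
        exact hk s ⟨hs.1.le, hs.2.trans ht.2.le⟩
      refine (intervalIntegral.norm_integral_le_of_norm_le_const hle).trans ?_
      rw [sub_zero, abs_of_pos ht.1]
      exact mul_le_mul_of_nonneg_left ht.2.le hη.le
    · refine eLpNormEssSup_le_of_ae_bound ?_
      filter_upwards [ae_restrict_mem measurableSet_Ioo] with t ht
      exact hk t ⟨ht.1.le, ht.2.le⟩
  rw [ENNReal.tendsto_nhds_zero]
  intro ε hε
  have h1 : Tendsto (fun η : ℝ => ENNReal.ofReal (η * T) + ENNReal.ofReal η) (𝓝[>] 0) (𝓝 0) := by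
    have : Continuous fun η : ℝ => ENNReal.ofReal (η * T) + ENNReal.ofReal η :=
      (ENNReal.continuous_ofReal.comp (by fun_prop)).add ENNReal.continuous_ofReal
    simpa using (this.tendsto 0).mono_left nhdsWithin_le_nhds
  obtain ⟨η, hη, hηε⟩ := (eventually_mem_nhdsWithin.and (h1.eventually_lt_const hε)).exists
  exact (key η hη).mono fun k hk => hk.trans hηε.le

/-- Compactness of functions that are Lipschitz up to an error that tends to `0`. -/
theorem exists_subseq_uniform_limit {w : ℕ → ℝ → ℝ} {ε : ℕ → ℝ} {b K : ℝ} (hK : 0 ≤ K)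
    (hε : Tendsto ε atTop (𝓝 0)) (hwb : ∀ k x, |w k x| ≤ b)
    (hwK : ∀ k, ∀ s ≥ 0, ∀ t ≥ 0, |w k t - w k s| ≤ K * (|t - s| + ε k)) :
    ∃ σ : ℕ → ℕ, StrictMono σ ∧ ∃ v : ℝ → ℝ, LipschitzWith (Real.toNNReal K) v ∧
      (∀ x, |v x| ≤ b) ∧
      ∀ T > 0, ∀ η > 0, ∀ᶠ k in atTop, ∀ t ∈ Icc 0 T, |w (σ k) t - v t| ≤ η := by
  obtain ⟨σ, hσ, l, hl⟩ := exists_subseq_forall_tendsto (a := fun k (q : ℚ) => w k q)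
    (b := fun _ => b) fun k q => hwb k q
  have hεσ := hε.comp hσ.tendsto_atTop
  have hc : ∀ t ≥ 0, ∃ y, Tendsto (fun k => w (σ k) t) atTop (𝓝 y) := by
    intro t ht
    have h1 := tendsto_zero_of_tendsto_rat (S := Ici 0) (l := (atTop ×ˢ atTop : Filter (ℕ × ℕ)))
      (d := fun p t => ‖w (σ p.1) t - w (σ p.2) t‖ₑ) (e := fun p => (ε (σ p.1) + ε (σ p.2)) / 2)
      (L := 2 * K) (isUpperSet_Ici 0)
      (by simpa using ((hεσ.comp tendsto_fst).add (hεσ.comp tendsto_snd)).div_const 2) ?_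
      (fun q _ => tendsto_enorm_sub_of_tendsto (hl q)) ht
    · apply cauchySeq_tendsto_of_complete
      rw [EMetric.cauchySeq_iff]
      intro η hη
      have h2 := h1.eventually_lt_const hη
      rw [prod_atTop_atTop_eq, eventually_atTop_prod_self'] at h2
      simpa only [edist_eq_enorm_sub] using h2
    · intro p s hs t ht
      have e : w (σ p.1) t - w (σ p.2) t = (w (σ p.1) s - w (σ p.2) s) +
          ((w (σ p.1) t - w (σ p.1) s) - (w (σ p.2) t - w (σ p.2) s)) := by ring
      simp only [e]
      refine (enorm_add_le _ _).trans ?_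
      gcongr
      rw [Real.enorm_eq_ofReal_abs]
      apply ENNReal.ofReal_le_ofReal
      have e1 := hwK (σ p.1) s hs t ht
      have e2 := hwK (σ p.2) s hs t ht
      have e3 := abs_sub (w (σ p.1) t - w (σ p.1) s) (w (σ p.2) t - w (σ p.2) s)
      linarith
  choose! y hy using hc
  have hyK : ∀ s ≥ 0, ∀ t ≥ 0, |y t - y s| ≤ K * |t - s| := by
    intro s hs t ht
    have h2 : Tendsto (fun k => K * (|t - s| + ε (σ k))) atTop (𝓝 (K * (|t - s| + 0))) :=
      (hεσ.const_add _).const_mul K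
    rw [add_zero] at h2
    exact le_of_tendsto_of_tendsto' ((hy t ht).sub (hy s hs)).abs h2 fun k => hwK _ s hs t ht
  -- The limit is controlled only for `t ≥ 0`; constant extension to the left makes it Lipschitz on
  -- the whole line.
  refine ⟨σ, hσ, fun t => y (max t 0), ?_, ?_, ?_⟩
  · refine LipschitzWith.of_dist_le_mul fun s t => ?_
    rw [Real.dist_eq, Real.dist_eq, Real.coe_toNNReal K hK]
    refine (hyK _ (le_max_right _ _) _ (le_max_right _ _)).trans ?_
    exact mul_le_mul_of_nonneg_left (abs_max_sub_max_le_abs s t 0) hK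
  · exact fun x => le_of_tendsto' (hy _ (le_max_right x 0)).abs fun k => hwb _ _
  · intro T hT η hη
    -- Comparison with a centre `s` of the finite cover costs `2 * K * δ` for `w`, `η / 8` at `s`
    -- and `K * δ` for the limit: at most `η / 2` in all.
    set δ := η / (8 * (K + 1)) with hδ
    have hδ0 : 0 < δ := by positivity
    have hKδ : K * δ ≤ η / 8 := by
      rw [hδ, mul_div_assoc', div_le_div_iff₀ (by positivity) (by norm_num)]
      nlinarith
    obtain ⟨F, hFs, hFf, hF⟩ := (isCompact_Icc (a := 0) (b := T)).finite_cover_balls hδ0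
    have h1 : ∀ᶠ k in atTop, ∀ s ∈ F, |w (σ k) s - y s| < η / 8 := by
      rw [hFf.eventually_all]
      intro s hs
      have := ((hy s (hFs hs).1).sub_const (y s)).abs
      rw [sub_self, abs_zero] at this
      exact this.eventually_lt_const (by positivity)
    have h2 : ∀ᶠ k in atTop, ε (σ k) < δ := hεσ.eventually_lt_const hδ0
    filter_upwards [h1, h2] with k hk1 hk2 t ht
    obtain ⟨s, hs, hts⟩ := mem_iUnion₂.1 (hF ht)
    rw [Metric.mem_ball, Real.dist_eq] at hts
    have e1 := hwK (σ k) s (hFs hs).1 t ht.1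
    have e2 := hyK s (hFs hs).1 t ht.1
    have e3 := hk1 s hs
    have e4 : K * (|t - s| + ε (σ k)) ≤ K * (δ + δ) := by gcongr
    have e5 : K * |t - s| ≤ K * δ := by gcongr
    simp only [max_eq_left ht.1]
    have e : w (σ k) t - y t = (w (σ k) t - w (σ k) s) + (w (σ k) s - y s) - (y t - y s) := by ring
    rw [e]
    refine (abs_sub _ _).trans ?_
    have := abs_add_le (w (σ k) t - w (σ k) s) (w (σ k) s - y s)
    linarith

end FluidParticle

/-! ### The proposition -/

theorem mainTheorem6 (D : SchemeData)
    (hlam : 0 < D.lam) (hmass : 0 < D.mass) (hmu : 0 < D.mu)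
    (hu0 : MemBV univ D.u0) (hflux : D.FluxHypotheses) (hCFL : D.CFL)
    (dt : ℕ → ℝ) (hdt : ∀ k, 0 < dt k) (hdt0 : Tendsto dt atTop (𝓝 0)) :
    ∃ (u : ℝ × ℝ → ℝ) (h : ℝ → ℝ) (σ : ℕ → ℕ),
      MemBVLoc u ∧ MemWInfLoc 2 h ∧ StrictMono σ ∧
      TendstoL1Loc (fun k => D.uApprox (dt (σ k))) u ∧
      TendstoW1InfLoc (fun k => D.hApprox (dt (σ k))) h := by
  obtain ⟨K, hK0, hK⟩ := SchemeData.exists_stepBounds hlam hmass hmu hflux hCFL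
  obtain ⟨V₀, hV₀, hVar⟩ := SchemeData.exists_seqVariation_initial_le hmu hu0
  have hV : ∀ τ > 0, seqVariation (D.shift (D.initial τ)) ≤ ENNReal.ofReal (V₀ + D.lam) := by
    intro τ hτ
    rw [ENNReal.ofReal_add hV₀ hlam.le]
    exact (SchemeData.seqVariation_shift_le hlam _).trans (by gcongr; exact hVar τ hτ)
  have hsmall : ∀ᶠ k in atTop, dt k * K < 1 := by
    have := hdt0.mul_const K
    rw [zero_mul] at this
    exact this.eventually_lt_const one_pos
  -- The velocity bound requires `dt k * K ≤ 1`, so finitely many time steps are discarded.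
  obtain ⟨N, hN⟩ := eventually_atTop.1 hsmall
  set τ : ℕ → ℝ := fun k => dt (k + N) with hτ
  have hτp : ∀ k, 0 < τ k := fun k => hdt _
  have hτ0 : Tendsto τ atTop (𝓝 0) := (tendsto_add_atTop_iff_nat N).2 hdt0
  have hB : ∀ k n, D.StepBounds K (τ k) n := fun k =>
    hK (τ k) (hτp k) (hN _ (Nat.le_add_left _ _)).le
      (SchemeData.inRegion_initial hmu hu0 (hτp k))
  have hV' : 0 ≤ V₀ + D.lam := by positivity
  have hvb : 0 ≤ D.velBound := (abs_nonneg _).trans (SchemeData.abs_velApprox_le (hB 0) 0)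
  obtain ⟨σ₁, hσ₁, v, hvL, hvb', hvlim⟩ := exists_subseq_uniform_limit
    (w := fun k => D.velApprox (τ k)) hK0.le hτ0
    (fun k => SchemeData.abs_velApprox_le (hB k))
    (fun k s hs t ht => SchemeData.abs_velApprox_sub_le (hτp k) (hB k) hK0.le hs ht)
  -- The jump `lam` enters the variation twice: once to shift the initial data, once to undo the
  -- shift at later times.
  have hU : UniformBV (fun k => D.uApprox (τ k)) τ (|D.lowerBound| + |D.upperBound|)
      (V₀ + D.lam + D.lam) ((V₀ + D.lam + D.lam) * D.velBound + (V₀ + D.lam) / D.mu) :=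
    { nonneg_V := by positivity
      nonneg_C := by positivity
      nonneg_eps := fun k => (hτp k).le
      tendsto_eps := hτ0
      measurable := fun k => D.measurable_uApprox _
      abs_le := fun k => SchemeData.abs_uApprox_le (hB k) hlam
      space_le := fun k => SchemeData.lintegral_uApprox_space_le (hτp k) (hB k) (hV _ (hτp k))
        hlam hmu hV'
      time_le := fun k s hs t ht => SchemeData.lintegral_uApprox_time_le (hτp k) (hB k)
        (hV _ (hτp k)) hlam hmu hV' hs ht }
  have hU₁ := hU.comp hσ₁
  obtain ⟨σ₂, hσ₂, u, hu, hulim⟩ := hU₁.exists_subseq_tendsto_halfPlaneWeight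
  refine ⟨u, fun t => D.h0 + ∫ s in (0 : ℝ)..t, v s, fun k => σ₁ (σ₂ k) + N,
    (hU₁.comp hσ₂).memBVLoc hu hulim, memWInfLoc_two_of_lipschitz hvL hvb',
    fun a b hab => Nat.add_lt_add_right (hσ₁ (hσ₂ hab)) N,
    UniformBV.tendstoL1Loc hulim, ?_⟩
  exact tendstoW1InfLoc_of_uniform (w := fun k => D.velApprox (τ (σ₁ (σ₂ k))))
    (fun k => D.measurable_velApprox _) (fun k => SchemeData.abs_velApprox_le (hB _))
    hvL.continuous.measurable hvb'
    (fun k t ht => SchemeData.hApprox_eq_integral (hτp _) (hB _) ht)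
    fun T hT η hη => hσ₂.tendsto_atTop.eventually (hvlim T hT η hη)
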